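/- **Theorem 1.** For integers $n,m\ge 0$ let $[n;m]=\{1,2,\dots,n,n+2,n+4,\dots,n+2m\}$ and $[k]=\{1,\dots,k\}$. For complex $a,b$ put $\bar a_k=a+(k-1)^2$, $\bar b_k=b+(k-1)^2$, $a_{2k}=\bar a_2\bar a_4\cdots\bar a_{2k}$, $a_{2k+1}=\bar a_1\bar a_3\cdots\bar a_{2k+1}$, and similarly $b_i$; for a finite set $S$ of positive integers let $a_S=\prod_{i\in S}a_i$, $b_S=\prod_{i\in S}b_i$, $|S|=\sum_{i\in S}i$. For $I\subset[n;m]$ let $$\mathbf d_{n,m}(I)=\prod_{i\in I,\ j\in[n;m]\setminus I}\left|\frac{i+j}{i-j}\right|,\qquad \mathbf c(I)=\sum_{i\in I,\ i>n}\frac{i-n}{2}.$$ The generalized Umemura polynomials are $$U^{(k)}_{n,m}(z,w;a,b)=\sum_{[k]\subset I\subset[n;m]}\ \prod_{i\in I\setminus[k],\ j\in[k]}\frac{i+j}{j-i}\ \mathbf d_{n,m}(I)\,(-1)^{\mathbf c(I)}\,a_{I\setminus[k]}\,b_{[n;m]\setminus I}\,z^{|I\setminus[k]|}w^{|[n;m]\setminus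 I|},$$ and $U_{n,m}=U^{(0)}_{n,m}$. Let $z,w$ be the functions $z=\frac12(e^x+e^{-x}-2)^{1/2}$, $w=\frac12(e^x+e^{-x}+2)^{1/2}$ of $x$ (nonnegative square roots for real $x\neq 0$; arbitrary holomorphic branches on any open set of complex $x$), let $'=d/dx$ and $D_x^2f\circ g=f''g-2f'g'+fg''$. Then for all $n\ge 0$, $m\ge 1$ and all $a,b\in\mathbb C$ $$U_{n,m-1}U_{n,m+1}=\left(-\bar a_{n+2m+2}z^2+\bar b_{n+2m+2}w^2\right)U_{n,m}^2+8z^2w^2\,D_x^2U_{n,m}\circ U_{n,m}-\frac{4}{(n+2m+1)^2}\,ab(a-b)\,z^2w^2\left(U^{(1)}_{n,m}\right)^2 .$$ For $n=0$ one has $U^{(1)}_{0,m}=0$, and the recurrence reduces to Umemura's recurrence in the following sense. There is exactly one sequence of polynomials $T_n\in\mathbb Q[b_1,b_2][v]$, $n\ge0$, with $T_0=T_1=1$ and, for all $n\ge1$, $$T_{n-1}T_{n+1}=\left\{\tfrac14\left(-2b_1^2-2b_2^2+(b_1^2-b_2^2)v\right)+\left(n-\tfrac12\right)^2\right\}T_n^2+\tfrac14(v^2-4)^2\left\{T_n\frac{d^2T_n}{dv^2}-\left(\frac{dT_n}{dv}\right)^2\right\}+\tfrac14(v^2-4)\,v\,T_n\frac{dT_n}{dv},$$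 and it is given by $2^{m(m+1)}T_{m+1}(v)=U_{0,m}(z,w;-4b_1^2,-4b_2^2)$ for all $m\ge0$ and all complex $b_1,b_2,v,z,w$ with $-z^2=\frac{2-v}{4}$ and $w^2=\frac{2+v}{4}$. -/

import Mathlib

noncomputable section

namespace Umemura

open Finset

/-- The index set `[n;m] = {1, 2, …, n, n+2, n+4, …, n+2m}`. -/
def idx (n m : ℕ) : Finset ℕ :=
  Icc 1 n ∪ (Icc 1 m).image (fun j => n + 2 * j)

/-- `d_{n,m}(I) = ∏_{i ∈ I, j ∈ [n;m] \ I} |(i+j)/(i-j)|`. -/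
def dCoeff (n m : ℕ) (I : Finset ℕ) : ℚ :=
  ∏ i ∈ I, ∏ j ∈ idx n m \ I, |((i : ℚ) + j) / ((i : ℚ) - j)|

/-- `c(I) = ∑_{i ∈ I, i > n} (i-n)/2`; for `I ⊆ [n;m]` every `i - n` occurring here is even. -/
def cExp (n : ℕ) (I : Finset ℕ) : ℕ :=
  ∑ i ∈ I with n < i, (i - n) / 2

/-- The shifted parameter `a + (k-1)^2`. -/
def bar (a : ℂ) (k : ℕ) : ℂ := a + ((k : ℂ) - 1) ^ 2

/-- `a_k`, the product of `bar a j` over all `1 ≤ j ≤ k` with the same parity as `k`. -/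
def low (a : ℂ) : ℕ → ℂ
  | 0 => 1
  | 1 => bar a 1
  | k + 2 => low a k * bar a (k + 2)

/-- `e_I^{(n,m,k)}(z,w) = a_{I∖[k]} b_{[n;m]∖I} z^{|I∖[k]|} w^{|[n;m]∖I|}`, where `|S|` is the
sum of the elements of `S`. -/
def eTerm (n m k : ℕ) (I : Finset ℕ) (z w a b : ℂ) : ℂ :=
  (∏ i ∈ I \ Icc 1 k, low a i) * (∏ i ∈ idx n m \ I, low b i) *
    z ^ (∑ i ∈ I \ Icc 1 k, i) * w ^ (∑ i ∈ idx n m \ I, i)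

/-- The generalized Umemura polynomial `U_{n,m}^{(k)}(z,w;a,b)`. The sum is over all `I` with
`[k] ⊆ I ⊆ [n;m]`. -/
def U (n m k : ℕ) (z w a b : ℂ) : ℂ :=
  ∑ I ∈ (idx n m).powerset with Icc 1 k ⊆ I,
    (((∏ i ∈ I \ Icc 1 k, ∏ j ∈ Icc 1 k, ((i : ℚ) + j) / ((j : ℚ) - i)) * dCoeff n m I *
      (-1) ^ cExp n I : ℚ) : ℂ) * eTerm n m k I z w a b

/-- The second Hirota derivative `D_x^2 f ∘ g = f'' g - 2 f' g' + f g''`. -/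
def hirotaD2 {𝕜 : Type*} [NontriviallyNormedField 𝕜] [NormedSpace 𝕜 ℂ] (f g : 𝕜 → ℂ)
    (x : 𝕜) : ℂ :=
  deriv (deriv f) x * g x - 2 * (deriv f x * deriv g x) + f x * deriv (deriv g) x

/-- The Toda-type recurrence for `U_{n,m} = U_{n,m}^{(0)}` at the point `x`, where `z` and `w` are
functions of `x`. -/
def TodaRecurrence {𝕜 : Type*} [NontriviallyNormedField 𝕜] [NormedSpace 𝕜 ℂ] (n m : ℕ)
    (a b : ℂ) (z w : 𝕜 → ℂ) (x : 𝕜) : Prop :=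
  U n (m - 1) 0 (z x) (w x) a b * U n (m + 1) 0 (z x) (w x) a b =
    (-bar a (n + 2 * m + 2) * z x ^ 2 + bar b (n + 2 * m + 2) * w x ^ 2) *
        U n m 0 (z x) (w x) a b ^ 2
      + 8 * z x ^ 2 * w x ^ 2 *
        hirotaD2 (fun t => U n m 0 (z t) (w t) a b) (fun t => U n m 0 (z t) (w t) a b) x
      - 4 / ((n : ℂ) + 2 * m + 1) ^ 2 * (a * b * (a - b)) * z x ^ 2 * w x ^ 2 *
        U n m 1 (z x) (w x) a b ^ 2

/-- Polynomials in the variable `v` whose coefficients are rational polynomials in two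
indeterminate parameters `b₁, b₂`. -/
abbrev ParamPoly : Type := Polynomial (MvPolynomial (Fin 2) ℚ)

/-- The parameter `b₁` (for `i = 0`) or `b₂` (for `i = 1`). -/
def param (i : Fin 2) : ParamPoly := Polynomial.C (MvPolynomial.X i)

/-- Umemura's recurrence in the variable `v`, with `T_0 = T_1 = 1`. -/
def IsUmemuraSeq (T : ℕ → ParamPoly) : Prop :=
  T 0 = 1 ∧ T 1 = 1 ∧ ∀ n : ℕ, 1 ≤ n →
    T (n - 1) * T (n + 1) =
      ((1 / 4 : ℚ) • (-2 * param 0 ^ 2 - 2 * param 1 ^ 2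
          + (param 0 ^ 2 - param 1 ^ 2) * Polynomial.X)
        + algebraMap ℚ ParamPoly (((n : ℚ) - 1 / 2) ^ 2)) * T n ^ 2
      + (1 / 4 : ℚ) • ((Polynomial.X ^ 2 - 4) ^ 2 *
          (T n * (T n).derivative.derivative - (T n).derivative ^ 2))
      + (1 / 4 : ℚ) • ((Polynomial.X ^ 2 - 4) * Polynomial.X * T n * (T n).derivative)

/-- The value of `P` at complex parameters `b₁, b₂` and at the complex point `v`. -/
def ParamPoly.value (P : ParamPoly) (b₁ b₂ v : ℂ) : ℂ :=
  Polynomial.eval₂ (MvPolynomial.aeval ![b₁, b₂] : MvPolynomial (Fin 2) ℚ →ₐ[ℚ] ℂ).toRingHom v P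

end Umemura

end

/-! Attach to each index `i` the function `φ_i(t) = α_i e^{it} + β_i e^{-it}` with `α_i =
-a_i(-z)^i` and `β_i = b_i w^i`. Up to a nonzero Vandermonde constant, `U_{n,m}` is the Wronskian
`τ_m` at `t = 0` of the `φ_i`, `i ∈ [n;m]`. Indeed, expanding the determinant along its rows picks
one exponential per index, i.e. a subset `I`, and the Vandermonde determinant of the signed indices,
divided by that of the all-negative ones, is `d(I)` up to sign (`vand_sgnVec`, `tauU_eq`). Leaving
out `φ_1` gives `U^{(1)}` in the same way (`U_one_eq`). Replacing `(z, w)` by `(z e^t, w e^{-t})`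
translates every `φ_i`, so `D = z∂_z - w∂_w` differentiates these Wronskians.

Two facts produce the recurrence. Let `τ↑` be `τ_m` with its last index raised by 2, and `τ↓` be
`τ_m` with `φ_1` replaced by `z e^t + w e^{-t}`. The Jacobi identity gives `τ_m Dτ↑ - τ↑ Dτ_m =
τ_{m-1} τ_{m+1}`, and for `n > 0` it makes the same expression in `τ↓` a multiple of the squared
Wronskian without `φ_1` (`jacobi_raised`, `jacobi_lowered`). Secondly, a combination of `τ↑` and
`τ↓` equals a combination of `Dτ_m` and `τ_m` (`linear_relation`): an operator moving `φ_i` to index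
`i ± 2` acts as a derivation on the determinant; nearly all resulting terms have a repeated row,
while on pure exponentials the sum is a residue sum that collapses to a linear function of the sum
of the exponents. Applying `D` to the linear relation and eliminating `τ↑` and `τ↓` yields
`bilinear_relation`, hence `toda_algebraic`, valid whenever `w² - z² = 1`.

It remains to change derivations. Along the curve, `d/dx` on the monomials of `U` is expressed by
`D` and the total degree (`hasDerivAt_Umom`), which turns `toda_algebraic` into the Hirota form. For
`n = 0` all indices are even, so `U` is a polynomial in `v = 4z² + 2`; the same identity rewritten
with `d/dv` is Umemura's recurrence. Uniqueness holds because no `T_n` vanishes, so `T_{n+1}` is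
found by cancellation. -/

noncomputable section
namespace Umemura
open Finset

/-! ### Partial fractions of `∏ (x - k i + 2) / (x - k i)` -/

section PartialFractions

variable {ι : Type*} [DecidableEq ι]

/-- Half the residue of `∏ (x - k j + 2) / (x - k j)` at `x = k i`. -/
def resWt (k : ι → ℂ) (s : Finset ι) (i : ι) : ℂ :=
  ∏ j ∈ s.erase i, (k i - k j + 2) / (k i - k j)

theorem resWt_insert_of_mem {k : ι → ℂ} {s : Finset ι} {x i : ι} (hk : Function.Injective k)
    (hx : x ∉ s) (hi : i ∈ s) :
    resWt k (insert x s) i = resWt k s i * (1 + 2 / (k i - k x)) := by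
  have hne : x ≠ i := fun h => hx (h ▸ hi)
  have hne' : k i - k x ≠ 0 := sub_ne_zero.2 fun h => hne (hk h).symm
  have : (insert x s).erase i = insert x (s.erase i) := by
    rw [erase_insert_of_ne hne]
  rw [resWt, this, prod_insert (fun h => hx (mem_of_mem_erase h)), resWt, mul_comm]
  congr 1
  field_simp

theorem resWt_insert_self {k : ι → ℂ} {s : Finset ι} {x : ι} (hx : x ∉ s) :
    resWt k (insert x s) x = ∏ j ∈ s, (k x - k j + 2) / (k x - k j) := by
  rw [resWt, erase_insert hx]

theorem prod_eq_one_add_sum_resWt {k : ι → ℂ} (hk : Function.Injective k) (s : Finset ι) :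
    ∀ y : ℂ, (∀ i ∈ s, y ≠ k i) →
      ∏ j ∈ s, (y - k j + 2) / (y - k j) = 1 + 2 * ∑ i ∈ s, resWt k s i / (y - k i) := by
  induction s using Finset.induction_on with
  | empty => simp
  | insert x s hx ih =>
    intro y hy
    have hys : ∀ i ∈ s, y ≠ k i := fun i hi => hy i (mem_insert_of_mem hi)
    have hyx : y - k x ≠ 0 := sub_ne_zero.2 (hy x (mem_insert_self _ _))
    have hxs : ∀ i ∈ s, k x ≠ k i := fun i hi h => hx (hk h ▸ hi)
    rw [prod_insert hx, sum_insert hx, resWt_insert_self hx, ih _ hys, ih _ hxs]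
    have : ∑ i ∈ s, resWt k (insert x s) i / (y - k i) =
        ∑ i ∈ s, resWt k s i / (y - k i) + 2 / (y - k x) *
          (∑ i ∈ s, resWt k s i / (y - k i) - ∑ i ∈ s, resWt k s i / (k x - k i)) := by
      rw [← sum_sub_distrib, mul_sum, ← sum_add_distrib]
      refine sum_congr rfl fun i hi => ?_
      rw [resWt_insert_of_mem hk hx hi]
      have h1 : y - k i ≠ 0 := sub_ne_zero.2 (hys i hi)
      have h2 : k x - k i ≠ 0 := sub_ne_zero.2 (hxs i hi)
      have h3 : k i - k x ≠ 0 := sub_ne_zero.2 (hxs i hi).symm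
      have h4 : 2 / (k i - k x) = - (2 / (k x - k i)) := by
        rw [← neg_sub (k x) (k i), div_neg]
      rw [h4]
      field_simp
      ring
    rw [this]
    field_simp
    ring

/-- The moments of the residues. -/
def resMoment (k : ι → ℂ) (s : Finset ι) (r : ℕ) : ℂ := ∑ i ∈ s, k i ^ r * resWt k s i

/-- The new residue is the partial fraction expansion evaluated at `k x`; its poles cancel against
the correction factors of the old residues, leaving the geometric sums `(k_i^r - k_x^r) / (k_i -
k_x)`. -/
theorem resMoment_insert {k : ι → ℂ} (hk : Function.Injective k) {s : Finset ι} {x : ι}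
    (hx : x ∉ s) (r : ℕ) :
    resMoment k (insert x s) r = resMoment k s r + k x ^ r +
      2 * ∑ l ∈ range r, k x ^ (r - 1 - l) * resMoment k s l := by
  have hxs : ∀ i ∈ s, k x ≠ k i := fun i hi h => hx (hk h ▸ hi)
  rw [resMoment, sum_insert hx, resWt_insert_self hx, prod_eq_one_add_sum_resWt hk s _ hxs]
  have key : ∀ i ∈ s, k i ^ r * resWt k (insert x s) i = k i ^ r * resWt k s i +
      2 * (∑ l ∈ range r, k x ^ (r - 1 - l) * (k i ^ l * resWt k s i)) -
      2 * k x ^ r * (resWt k s i / (k x - k i)) := by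
    intro i hi
    have h2 : k i - k x ≠ 0 := sub_ne_zero.2 (hxs i hi).symm
    have h3 : k x - k i ≠ 0 := sub_ne_zero.2 (hxs i hi)
    have h4 : 2 / (k i - k x) = - (2 / (k x - k i)) := by
      rw [← neg_sub (k x) (k i), div_neg]
    have hg := (Commute.all (k i) (k x)).geom_sum₂_mul r
    have hs : ∑ l ∈ range r, k x ^ (r - 1 - l) * (k i ^ l * resWt k s i) =
        resWt k s i * ∑ l ∈ range r, k i ^ l * k x ^ (r - 1 - l) := by
      rw [mul_sum]; exact sum_congr rfl fun l _ => by ring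
    rw [resWt_insert_of_mem hk hx hi, hs, h4]
    field_simp
    linear_combination 2 * resWt k s i * hg
  rw [sum_congr rfl key, sum_sub_distrib, sum_add_distrib, ← mul_sum, ← mul_sum, sum_comm]
  simp only [resMoment, ← mul_sum]
  ring

/-- The moments are symmetric polynomials in the `k i`, written here in power sums. Order 4
suffices, since `sum_gapQuad_resWt` integrates a quartic. -/
theorem resMoment_eq {k : ι → ℂ} (hk : Function.Injective k) (s : Finset ι) :
    resMoment k s 0 = #s ∧
    resMoment k s 1 = ∑ i ∈ s, k i + #s * (#s - 1) ∧
    resMoment k s 2 = ∑ i ∈ s, k i ^ 2 + 2 * (#s - 1) * ∑ i ∈ s, k i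
      + 2 / 3 * (#s * (#s - 1) * (#s - 2)) ∧
    resMoment k s 3 = ∑ i ∈ s, k i ^ 3 + (2 * #s - 3) * ∑ i ∈ s, k i ^ 2 + (∑ i ∈ s, k i) ^ 2
      + 2 * (#s - 1) * (#s - 2) * ∑ i ∈ s, k i
      + 1 / 3 * (#s * (#s - 1) * (#s - 2) * (#s - 3)) ∧
    resMoment k s 4 = ∑ i ∈ s, k i ^ 4 + (2 * #s - 4) * ∑ i ∈ s, k i ^ 3
      + 2 * (∑ i ∈ s, k i) * ∑ i ∈ s, k i ^ 2 + 2 * (#s - 2) ^ 2 * ∑ i ∈ s, k i ^ 2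
      + 2 * (#s - 2) * (∑ i ∈ s, k i) ^ 2
      + 4 / 3 * ((#s - 1) * (#s - 2) * (#s - 3)) * ∑ i ∈ s, k i
      + 2 / 15 * (#s * (#s - 1) * (#s - 2) * (#s - 3) * (#s - 4)) := by
  induction s using Finset.induction_on with
  | empty => simp [resMoment]
  | insert x s hx ih =>
    obtain ⟨h0, h1, h2, h3, h4⟩ := ih
    simp only [resMoment_insert hk hx, sum_range_succ, sum_range_zero, sum_insert hx,
      card_insert_of_notMem hx, h0, h1, h2, h3, h4]
    push_cast
    refine ⟨?_, ?_, ?_, ?_, ?_⟩ <;> ring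

end PartialFractions

/-! ### Rows of exponentials and their Wronskian-type determinants -/

/-- The sequence of derivatives at `0` of `t ↦ exp (k t)`. -/
def expRow (k : ℂ) : ℕ → ℂ := fun j => k ^ j

/-- The determinant of the family `C` of rows on the columns `ρ`. -/
def wrAt {N : ℕ} (ρ : Fin N → ℕ) (C : Fin N → ℕ → ℂ) : ℂ :=
  (Matrix.of fun i j => C i (ρ j)).det

/-- The columns `0, …, N-1`, `N+1`. -/
def skipCol (N : ℕ) : Fin (N + 1) → ℕ := Fin.snoc (fun j : Fin N => (j : ℕ)) (N + 1)

/-- The Wronskian of rows of derivatives. -/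
def wr {N : ℕ} (C : Fin N → ℕ → ℂ) : ℂ := wrAt (fun j => (j : ℕ)) C

/-- The derivative of the Wronskian of rows of derivatives. -/
def wrD {N : ℕ} (C : Fin (N + 1) → ℕ → ℂ) : ℂ := wrAt (skipCol N) C

/-- The Vandermonde product. -/
def vand {N : ℕ} (v : Fin N → ℂ) : ℂ := (Matrix.vandermonde v).det

theorem wr_expRow {N : ℕ} (v : Fin N → ℂ) : wr (fun i => expRow (v i)) = vand v := rfl

/-- Each `v i` is a root of `P = ∏ (X - v i)`, so the last column is a combination of the columns
`0, …, N`; only the multiple of column `N` survives in the determinant, with factor `-P.coeff N`,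
the sum of the roots. -/
theorem wrD_expRow {N : ℕ} (v : Fin (N + 1) → ℂ) :
    wrD (fun i => expRow (v i)) = vand v * ∑ i, v i := by
  set P : Polynomial ℂ := ∏ i, (Polynomial.X - Polynomial.C (v i)) with hP
  have hdeg : P.natDegree = N + 1 := by
    rw [hP, Polynomial.natDegree_prod_of_monic _ _ fun i _ => Polynomial.monic_X_sub_C _]
    simp
  have hmon : P.Monic := Polynomial.monic_prod_of_monic _ _ fun i _ => Polynomial.monic_X_sub_C _
  have hnext : P.coeff N = -∑ i, v i := by
    have := Polynomial.prod_X_sub_C_nextCoeff (s := univ) v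
    rw [← hP, Polynomial.nextCoeff_of_natDegree_pos (by omega), hdeg] at this
    simpa using this
  have hroot : ∀ i, v i ^ (N + 1) = ∑ j : Fin (N + 1), (-P.coeff j) * v i ^ (j : ℕ) := by
    intro i
    have h0 : P.eval (v i) = 0 := by
      rw [hP, Polynomial.eval_prod]
      exact prod_eq_zero (mem_univ i) (by simp)
    rw [Polynomial.eval_eq_sum_range, hdeg, sum_range_succ, ← hdeg, hmon.coeff_natDegree, hdeg,
      one_mul, ← Fin.sum_univ_eq_sum_range (fun j => P.coeff j * v i ^ j) (N + 1)] at h0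
    simp only [neg_mul, sum_neg_distrib]
    linear_combination h0
  have hmat : (Matrix.of fun i j => expRow (v i) (skipCol N j)) =
      (Matrix.vandermonde v).updateCol (Fin.last N)
        (fun i => ∑ j : Fin (N + 1), (-P.coeff (j : ℕ)) • (Matrix.vandermonde v) i j) := by
    ext i j
    refine Fin.lastCases ?_ (fun j => ?_) j
    · simp [skipCol, expRow, hroot i, Matrix.vandermonde_apply]
    · rw [Matrix.updateCol_ne (Fin.castSucc_lt_last j).ne]
      simp [skipCol, expRow, Matrix.vandermonde_apply]
  rw [wrD, wrAt, hmat, Matrix.det_updateCol_sum]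
  simp [vand, hnext, mul_comm]

/-- By Lagrange interpolation the row of powers of `x` is a combination of the rows at the nodes;
only the basis polynomial of node `i` contributes. -/
theorem vand_update {N : ℕ} {v : Fin N → ℂ} (hv : Function.Injective v) (i : Fin N) (x : ℂ) :
    vand (Function.update v i x) = vand v * ∏ j ∈ univ.erase i, (x - v j) / (v i - v j) := by
  have hrow : Matrix.vandermonde (Function.update v i x) =
      (Matrix.vandermonde v).updateRow i
        (∑ j, ((Lagrange.basis univ v j).eval x) • (Matrix.vandermonde v) j) := by
    ext i' l
    have hl : x ^ (l : ℕ) = ∑ j, (Lagrange.basis univ v j).eval x * v j ^ (l : ℕ) := by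
      have h := Lagrange.eq_interpolate (s := univ) (f := (Polynomial.X : Polynomial ℂ) ^ (l : ℕ))
        hv.injOn (by simp)
      have h' := congrArg (Polynomial.eval x) h
      rw [Lagrange.interpolate_apply, Polynomial.eval_finsetSum] at h'
      simpa [mul_comm] using h'
    by_cases h : i' = i
    · subst h
      simp [Matrix.vandermonde_apply, hl]
    · simp [Matrix.updateRow_ne h, Matrix.vandermonde_apply, Function.update_of_ne h]
  rw [vand, hrow, Matrix.det_updateRow_sum, Lagrange.basis, Polynomial.eval_prod, smul_eq_mul,
    mul_comm, vand]
  congr 1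
  refine prod_congr rfl fun j _ => ?_
  simp [Lagrange.basisDivisor, div_eq_inv_mul]

theorem wrAt_smul {N : ℕ} (ρ : Fin N → ℕ) (c : Fin N → ℂ) (X : Fin N → ℕ → ℂ) :
    wrAt ρ (fun i => c i • X i) = (∏ i, c i) * wrAt ρ X :=
  Matrix.det_mul_column c (Matrix.of fun i j => X i (ρ j))

theorem wrAt_add {N : ℕ} (ρ : Fin N → ℕ) (X Y : Fin N → ℕ → ℂ) :
    wrAt ρ (fun i => X i + Y i) = ∑ J : Finset (Fin N), wrAt ρ (J.piecewise X Y) := by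
  have h := (Matrix.detRowAlternating (R := ℂ) (n := Fin N)).map_add_univ
    (fun i j => X i (ρ j)) (fun i j => Y i (ρ j))
  refine Eq.trans h (sum_congr rfl fun J _ => ?_)
  rw [wrAt]
  congr 1
  ext i j
  by_cases hi : i ∈ J <;> simp [hi]

theorem wrAt_add_smul {N : ℕ} (ρ : Fin N → ℕ) (α β : Fin N → ℂ) (X Y : Fin N → ℕ → ℂ) :
    wrAt ρ (fun i => α i • X i + β i • Y i) =
      ∑ J : Finset (Fin N), ((∏ i ∈ J, α i) * ∏ i ∈ Jᶜ, β i) * wrAt ρ (J.piecewise X Y) := by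
  rw [wrAt_add]
  refine sum_congr rfl fun J _ => ?_
  have h1 : J.piecewise (fun i => α i • X i) (fun i => β i • Y i) =
      fun i => J.piecewise α β i • J.piecewise X Y i := by
    ext i j
    by_cases hi : i ∈ J <;> simp [hi]
  rw [h1, wrAt_smul, prod_piecewise]
  simp [compl_eq_univ_sdiff]

theorem wrAt_update_add {N : ℕ} (ρ : Fin N → ℕ) (X : Fin N → ℕ → ℂ) (i : Fin N) (x y : ℕ → ℂ) :
    wrAt ρ (Function.update X i (x + y)) =
      wrAt ρ (Function.update X i x) + wrAt ρ (Function.update X i y) := by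
  have key : ∀ x : ℕ → ℂ, wrAt ρ (Function.update X i x) =
      ((Matrix.of fun i j => X i (ρ j)).updateRow i (fun j => x (ρ j))).det := by
    intro x
    rw [wrAt]
    congr 1
    ext i' j
    by_cases h : i' = i
    · subst h; simp
    · simp [h]
  rw [key, key, key, ← Matrix.det_updateRow_add]
  rfl

theorem wrAt_update_smul {N : ℕ} (ρ : Fin N → ℕ) (X : Fin N → ℕ → ℂ) (i : Fin N) (c : ℂ)
    (x : ℕ → ℂ) :
    wrAt ρ (Function.update X i (c • x)) = c * wrAt ρ (Function.update X i x) := by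
  have key : ∀ x : ℕ → ℂ, wrAt ρ (Function.update X i x) =
      ((Matrix.of fun i j => X i (ρ j)).updateRow i (fun j => x (ρ j))).det := by
    intro x
    rw [wrAt]
    congr 1
    ext i' j
    by_cases h : i' = i
    · subst h; simp
    · simp [h]
  rw [key, key, ← Matrix.det_updateRow_smul]
  rfl

theorem wrAt_eq_zero_of_eq {N : ℕ} (ρ : Fin N → ℕ) (X : Fin N → ℕ → ℂ) {i j : Fin N} (hij : i ≠ j)
    (h : X i = X j) : wrAt ρ X = 0 :=
  Matrix.det_zero_of_row_eq hij (by ext l; simp [h])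

/-- The vector `κ` with the signs of the entries outside `J` reversed. -/
def sgnVec {N : ℕ} (J : Finset (Fin N)) (κ : Fin N → ℂ) : Fin N → ℂ := J.piecewise κ (-κ)

/-- The row of derivatives at `0` of `t ↦ α exp (κ t) + β exp (-κ t)`. -/
def solRow (κ α β : ℂ) : ℕ → ℂ := α • expRow κ + β • expRow (-κ)

/-- The moments of the expansion of the Wronskian of soliton rows into exponentials. -/
def tau {N : ℕ} (r : ℕ) (κ α β : Fin N → ℂ) : ℂ :=
  ∑ J : Finset (Fin N), ((∏ i ∈ J, α i) * ∏ i ∈ Jᶜ, β i) *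
    (vand (sgnVec J κ) * (∑ i, sgnVec J κ i) ^ r)

theorem piecewise_expRow {N : ℕ} (J : Finset (Fin N)) (κ : Fin N → ℂ) :
    J.piecewise (fun i => expRow (κ i)) (fun i => expRow (-κ i)) =
      fun i => expRow (sgnVec J κ i) := by
  ext i j
  by_cases hi : i ∈ J <;> simp [hi, sgnVec]

theorem wr_solRow {N : ℕ} (κ α β : Fin N → ℂ) :
    wr (fun i => solRow (κ i) (α i) (β i)) = tau 0 κ α β := by
  simp only [wr, solRow, wrAt_add_smul, tau, piecewise_expRow, pow_zero, mul_one]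
  rfl

theorem wrD_solRow {N : ℕ} (κ α β : Fin (N + 1) → ℂ) :
    wrD (fun i => solRow (κ i) (α i) (β i)) = tau 1 κ α β := by
  simp only [wrD, solRow, wrAt_add_smul, tau, piecewise_expRow, pow_one, ← wrD_expRow]

/-! ### The Jacobi identity -/

/-- When `A` is invertible, each bordered determinant is `det A` times an entry of the 2×2 Schur
complement, and the full determinant is `det A` times the determinant of that complement. -/
theorem jacobi_block_of_isUnit {n : Type*} [Fintype n] [DecidableEq n] (A : Matrix n n ℂ)
    (hA : IsUnit A.det) (B : Matrix n (Fin 2) ℂ) (C : Matrix (Fin 2) n ℂ)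
    (D : Matrix (Fin 2) (Fin 2) ℂ) (M : Fin 2 → Fin 2 → ℂ)
    (hM : ∀ a b, M a b = (Matrix.fromBlocks A (Matrix.of fun i (_ : Fin 1) => B i b)
      (Matrix.of fun (_ : Fin 1) j => C a j) (Matrix.of fun _ _ => D a b)).det) :
    M 0 0 * M 1 1 - M 0 1 * M 1 0 = A.det * (Matrix.fromBlocks A B C D).det := by
  let _ : Invertible A := A.invertibleOfIsUnitDet hA
  have key : ∀ a b, M a b = A.det * (D - C * ⅟A * B) a b := by
    intro a b
    rw [hM, Matrix.det_fromBlocks₁₁, Matrix.det_fin_one]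
    congr 1
  rw [Matrix.det_fromBlocks₁₁, Matrix.det_fin_two, key, key, key, key]
  ring

theorem jacobi_block {n : Type*} [Fintype n] [DecidableEq n] (A : Matrix n n ℂ)
    (B : Matrix n (Fin 2) ℂ) (C : Matrix (Fin 2) n ℂ)
    (D : Matrix (Fin 2) (Fin 2) ℂ) (M : Fin 2 → Fin 2 → ℂ)
    (hM : ∀ a b, M a b = (Matrix.fromBlocks A (Matrix.of fun i (_ : Fin 1) => B i b)
      (Matrix.of fun (_ : Fin 1) j => C a j) (Matrix.of fun _ _ => D a b)).det) :
    M 0 0 * M 1 1 - M 0 1 * M 1 0 = A.det * (Matrix.fromBlocks A B C D).det := by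
  -- The singular case follows by continuity: `t + A` is invertible off the finitely many roots of
  -- the characteristic polynomial of `-A`, a dense set of `t`.
  let At : ℂ → Matrix n n ℂ := fun t => t • 1 + A
  let Mt : ℂ → Fin 2 → Fin 2 → ℂ := fun t a b =>
    (Matrix.fromBlocks (At t) (Matrix.of fun i (_ : Fin 1) => B i b)
      (Matrix.of fun (_ : Fin 1) j => C a j) (Matrix.of fun _ _ => D a b)).det
  have hAt : Continuous At := by fun_prop
  have hMt : ∀ a b, Continuous fun t => Mt t a b := fun a b =>
    (hAt.matrix_fromBlocks continuous_const continuous_const continuous_const).matrix_det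
  have hfull : Continuous fun t => (Matrix.fromBlocks (At t) B C D).det :=
    (hAt.matrix_fromBlocks continuous_const continuous_const continuous_const).matrix_det
  have hroots : {t : ℂ | ¬ IsUnit (At t).det}.Finite := by
    refine ((-A).charpoly.roots.toFinset.finite_toSet).subset fun t ht => ?_
    have h0 : (At t).det = 0 := by simpa using ht
    have : (-A).charpoly.eval t = (At t).det := by
      rw [Matrix.eval_charpoly]
      congr 1
      ext i j
      simp [At, Matrix.scalar_apply, Matrix.diagonal_apply, Matrix.one_apply]
    simp only [Finset.mem_coe, Multiset.mem_toFinset]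
    exact (Polynomial.mem_roots (-A).charpoly_monic.ne_zero).2 (by
      rw [Polynomial.IsRoot, this, h0])
  have hdense : Dense {t : ℂ | ¬ IsUnit (At t).det}ᶜ := hroots.countable.dense_compl ℝ
  have heq := Continuous.ext_on hdense
    (((hMt 0 0).mul (hMt 1 1)).sub ((hMt 0 1).mul (hMt 1 0))) (hAt.matrix_det.mul hfull)
    (fun t ht => jacobi_block_of_isUnit (At t) (not_not.1 ht) B C D (Mt t) fun a b => rfl)
  have h0 := congrFun heq 0
  simpa [Mt, At, ← hM] using h0

theorem wrAt_snoc_eq_det {N : ℕ} (r : Fin N → ℕ) (c : ℕ) (S : Fin N → ℕ → ℂ) (x : ℕ → ℂ) :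
    wrAt (Fin.snoc r c : Fin (N + 1) → ℕ) (Fin.snoc S x : Fin (N + 1) → ℕ → ℂ) =
      (Matrix.fromBlocks (Matrix.of fun i j => S i (r j)) (Matrix.of fun i (_ : Fin 1) => S i c)
        (Matrix.of fun (_ : Fin 1) j => x (r j)) (Matrix.of fun _ _ => x c)).det := by
  rw [wrAt, ← Matrix.det_submatrix_equiv_self (finSumFinEquiv (m := N) (n := 1))]
  congr 1
  ext i j
  have hl : ∀ a : Fin 1, Fin.natAdd N a = Fin.last N := by
    intro a; ext; simp
  have hc : ∀ a : Fin N, Fin.castAdd 1 a = a.castSucc := fun a => rfl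
  rcases i with i | i <;> rcases j with j | j <;>
    simp [hl, hc]

theorem wrAt_snoc_snoc_eq_det {N : ℕ} (r : Fin N → ℕ) (c d : ℕ) (S : Fin N → ℕ → ℂ)
    (x y : ℕ → ℂ) :
    wrAt (Fin.snoc (Fin.snoc r c : Fin (N + 1) → ℕ) d : Fin (N + 2) → ℕ)
      (Fin.snoc (Fin.snoc S x : Fin (N + 1) → ℕ → ℂ) y : Fin (N + 2) → ℕ → ℂ) =
      (Matrix.fromBlocks (Matrix.of fun i j => S i (r j))
        (Matrix.of fun i (b : Fin 2) => S i (![c, d] b))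
        (Matrix.of fun (a : Fin 2) j => ![x, y] a (r j))
        (Matrix.of fun a b => ![x, y] a (![c, d] b))).det := by
  rw [wrAt, ← Matrix.det_submatrix_equiv_self (finSumFinEquiv (m := N) (n := 2))]
  congr 1
  ext i j
  have hl : Fin.natAdd N (1 : Fin 2) = Fin.last (N + 1) := by
    ext; simp
  have hl' : Fin.natAdd N (0 : Fin 2) = (Fin.last N).castSucc := by
    ext; simp
  have hc : ∀ a : Fin N, Fin.castAdd 2 a = a.castSucc.castSucc := fun a => rfl
  rcases i with i | i <;> rcases j with j | j <;> (try fin_cases i) <;> (try fin_cases j) <;>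
    simp [hl, hl', hc]

theorem jacobi_wrAt {N : ℕ} (r : Fin N → ℕ) (c d : ℕ) (S : Fin N → ℕ → ℂ) (x y : ℕ → ℂ) :
    wrAt (Fin.snoc r c : Fin (N + 1) → ℕ) (Fin.snoc S x : Fin (N + 1) → ℕ → ℂ) *
        wrAt (Fin.snoc r d : Fin (N + 1) → ℕ) (Fin.snoc S y : Fin (N + 1) → ℕ → ℂ) -
      wrAt (Fin.snoc r d : Fin (N + 1) → ℕ) (Fin.snoc S x : Fin (N + 1) → ℕ → ℂ) *
        wrAt (Fin.snoc r c : Fin (N + 1) → ℕ) (Fin.snoc S y : Fin (N + 1) → ℕ → ℂ) =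
      wrAt r S * wrAt (Fin.snoc (Fin.snoc r c : Fin (N + 1) → ℕ) d : Fin (N + 2) → ℕ)
        (Fin.snoc (Fin.snoc S x : Fin (N + 1) → ℕ → ℂ) y : Fin (N + 2) → ℕ → ℂ) := by
  rw [wrAt_snoc_snoc_eq_det]
  exact jacobi_block _ _ _ _
    (fun a b => wrAt (Fin.snoc r (![c, d] b) : Fin (N + 1) → ℕ)
      (Fin.snoc S (![x, y] a) : Fin (N + 1) → ℕ → ℂ))
    (fun a b => wrAt_snoc_eq_det _ _ _ _)

theorem val_eq_snoc (N : ℕ) :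
    (fun j : Fin (N + 1) => (j : ℕ)) = Fin.snoc (fun j : Fin N => (j : ℕ)) N := by
  ext j
  refine Fin.lastCases ?_ (fun j => ?_) j <;> simp

/-- The Jacobi identity for Wronskians. -/
theorem jacobi_wr {N : ℕ} (S : Fin N → ℕ → ℂ) (x y : ℕ → ℂ) :
    wr (Fin.snoc S x : Fin (N + 1) → ℕ → ℂ) * wrD (Fin.snoc S y : Fin (N + 1) → ℕ → ℂ) -
      wrD (Fin.snoc S x : Fin (N + 1) → ℕ → ℂ) * wr (Fin.snoc S y : Fin (N + 1) → ℕ → ℂ) =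
      wr S * wr (Fin.snoc (Fin.snoc S x : Fin (N + 1) → ℕ → ℂ) y : Fin (N + 2) → ℕ → ℂ) := by
  have h := jacobi_wrAt (fun j : Fin N => (j : ℕ)) N (N + 1) S x y
  rw [← val_eq_snoc, ← val_eq_snoc] at h
  exact h

theorem wrAt_cons {N : ℕ} (ρ : Fin (N + 1) → ℕ) (S : Fin N → ℕ → ℂ) (x : ℕ → ℂ) :
    wrAt ρ (Fin.cons x S : Fin (N + 1) → ℕ → ℂ) =
      (-1) ^ N * wrAt ρ (Fin.snoc S x : Fin (N + 1) → ℕ → ℂ) := by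
  have h : (Matrix.of fun i j => (Fin.snoc S x : Fin (N + 1) → ℕ → ℂ) i (ρ j)) =
      (Matrix.of fun i j => (Fin.cons x S : Fin (N + 1) → ℕ → ℂ) i (ρ j)).submatrix
        (finRotate (N + 1)) id := by
    ext i j
    simp [Fin.snoc_eq_cons_rotate]
  rw [wrAt, wrAt, h, Matrix.det_permute, sign_finRotate]
  simp only [Units.val_pow_eq_pow_val, Units.val_neg, Units.val_one, Int.cast_pow, Int.cast_neg,
    Int.cast_one]
  rw [← mul_assoc, Nat.add_sub_cancel, ← mul_pow]
  simp

/-- The Jacobi identity for Wronskians that differ in their first function. -/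
theorem jacobi_wr_cons {N : ℕ} (S : Fin N → ℕ → ℂ) (x y : ℕ → ℂ) :
    wr (Fin.cons x S : Fin (N + 1) → ℕ → ℂ) * wrD (Fin.cons y S : Fin (N + 1) → ℕ → ℂ) -
      wrD (Fin.cons x S : Fin (N + 1) → ℕ → ℂ) * wr (Fin.cons y S : Fin (N + 1) → ℕ → ℂ) =
      wr S * wr (Fin.snoc (Fin.snoc S x : Fin (N + 1) → ℕ → ℂ) y : Fin (N + 2) → ℕ → ℂ) := by
  have h1 : ((-1 : ℂ) ^ N) * (-1) ^ N = 1 := by rw [← mul_pow]; simp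
  rw [← jacobi_wr]
  simp only [wr, wrD, wrAt_cons]
  linear_combination (wrAt (fun j => (j : ℕ)) (Fin.snoc S x : Fin (N + 1) → ℕ → ℂ) *
    wrAt (skipCol N) (Fin.snoc S y : Fin (N + 1) → ℕ → ℂ) -
    wrAt (skipCol N) (Fin.snoc S x : Fin (N + 1) → ℕ → ℂ) *
    wrAt (fun j => (j : ℕ)) (Fin.snoc S y : Fin (N + 1) → ℕ → ℂ)) * h1

/-! ### The increasing enumeration of the index sets -/

/-- The increasing enumeration of `{1, …, n, n+2, n+4, …}`. -/
def kap (n j : ℕ) : ℕ := if j < n then j + 1 else n + 2 * (j + 1 - n)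

theorem kap_strictMono (n : ℕ) : StrictMono (kap n) := by
  refine strictMono_nat_of_lt_succ fun j => ?_
  unfold kap
  split_ifs <;> omega

theorem kap_pos (n j : ℕ) : 0 < kap n j := by
  unfold kap
  split_ifs <;> omega

theorem sum_range_kap (n m : ℕ) (f : ℕ → ℂ) :
    ∑ i : Fin (n + m), f (kap n i) =
      ∑ j ∈ range n, f (j + 1) + ∑ j ∈ range m, f (n + 2 * (j + 1)) := by
  rw [Fin.sum_univ_eq_sum_range (fun j => f (kap n j)), sum_range_add]
  congr 1
  · exact sum_congr rfl fun j hj => by rw [kap, if_pos (mem_range.1 hj)]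
  · refine sum_congr rfl fun j _ => ?_
    rw [kap, if_neg (by omega)]
    congr 2
    omega

theorem sum_kap (n m : ℕ) :
    ∑ i : Fin (n + m), (kap n i : ℂ) = n * (n + 1) / 2 + m * n + m * (m + 1) := by
  rw [sum_range_kap n m fun j => (j : ℂ)]
  have h1 : ∑ j ∈ range n, ((j + 1 : ℕ) : ℂ) = n * (n + 1) / 2 := by
    induction n with
    | zero => simp
    | succ n ih => rw [sum_range_succ, ih]; push_cast; ring
  have h2 : ∑ j ∈ range m, ((n + 2 * (j + 1) : ℕ) : ℂ) = m * n + m * (m + 1) := by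
    induction m with
    | zero => simp
    | succ m ih => rw [sum_range_succ, ih]; push_cast; ring
  rw [h1, h2, add_assoc]

theorem sum_kap_sq (n m : ℕ) :
    ∑ i : Fin (n + m), (kap n i : ℂ) ^ 2 = n * (n + 1) * (2 * n + 1) / 6 + m * n ^ 2
      + 2 * n * (m * (m + 1)) + 2 * (m * (m + 1) * (2 * m + 1)) / 3 := by
  rw [sum_range_kap n m fun j => (j : ℂ) ^ 2]
  have h1 : ∑ j ∈ range n, ((j + 1 : ℕ) : ℂ) ^ 2 = n * (n + 1) * (2 * n + 1) / 6 := by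
    induction n with
    | zero => simp
    | succ n ih => rw [sum_range_succ, ih]; push_cast; ring
  have h2 : ∑ j ∈ range m, ((n + 2 * (j + 1) : ℕ) : ℂ) ^ 2 = m * n ^ 2
      + 2 * n * (m * (m + 1)) + 2 * (m * (m + 1) * (2 * m + 1)) / 3 := by
    induction m with
    | zero => simp
    | succ m ih => rw [sum_range_succ, ih]; push_cast; ring
  rw [h1, h2]
  ring

theorem sum_kap_pow_four (n m : ℕ) :
    ∑ i : Fin (n + m), (kap n i : ℂ) ^ 4 =
      n * (n + 1) * (2 * n + 1) * (3 * n ^ 2 + 3 * n - 1) / 30 + m * n ^ 4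
      + 4 * n ^ 3 * (m * (m + 1)) + 4 * n ^ 2 * (m * (m + 1) * (2 * m + 1))
      + 8 * n * (m * (m + 1)) ^ 2
      + 8 * (m * (m + 1) * (2 * m + 1) * (3 * m ^ 2 + 3 * m - 1)) / 15 := by
  rw [sum_range_kap n m fun j => (j : ℂ) ^ 4]
  have h1 : ∑ j ∈ range n, ((j + 1 : ℕ) : ℂ) ^ 4 =
      n * (n + 1) * (2 * n + 1) * (3 * n ^ 2 + 3 * n - 1) / 30 := by
    induction n with
    | zero => simp
    | succ n ih => rw [sum_range_succ, ih]; push_cast; ring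
  have h2 : ∑ j ∈ range m, ((n + 2 * (j + 1) : ℕ) : ℂ) ^ 4 = m * n ^ 4
      + 4 * n ^ 3 * (m * (m + 1)) + 4 * n ^ 2 * (m * (m + 1) * (2 * m + 1))
      + 8 * n * (m * (m + 1)) ^ 2
      + 8 * (m * (m + 1) * (2 * m + 1) * (3 * m ^ 2 + 3 * m - 1)) / 15 := by
    induction m with
    | zero => simp
    | succ m ih => rw [sum_range_succ, ih]; push_cast; ring
  rw [h1, h2]
  ring

/-- The enumeration of `[n;m]` as a complex vector. -/
def kapVec (n N : ℕ) : Fin N → ℂ := fun i => (kap n i : ℂ)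

theorem sgnVec_sq {N : ℕ} (J : Finset (Fin N)) (κ : Fin N → ℂ) (i : Fin N) :
    sgnVec J κ i ^ 2 = κ i ^ 2 := by
  by_cases hi : i ∈ J <;> simp [sgnVec, hi]

theorem sgnVec_injective {N : ℕ} (J : Finset (Fin N)) {ν : Fin N → ℕ} (hν : Function.Injective ν) :
    Function.Injective (sgnVec J fun i => (ν i : ℂ)) := by
  intro i j hij
  have h2 : ((ν i : ℂ)) ^ 2 = (ν j : ℂ) ^ 2 := by
    have := congrArg (· ^ 2) hij
    simpa only [sgnVec_sq] using this
  have h3 : ν i ^ 2 = ν j ^ 2 := by exact_mod_cast h2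
  exact hν (Nat.pow_left_injective (n := 2) (by norm_num) h3)

theorem kap_injective (n N : ℕ) : Function.Injective fun i : Fin N => kap n i :=
  (kap_strictMono n).injective.comp Fin.val_injective

/-- The polynomial `(x + 1 - n) (x + 1 - n - 2m)`. -/
def gapQuad (n m : ℕ) (x : ℂ) : ℂ := (x + 1 - n) * (x + 1 - (n + 2 * m))

/-- This explains `gapQuad`. Flipping signs of the `k i` changes only the odd power sums. The roots
`n - 1` and `n + 2m - 1` add up to `2(n + m) - 2`, which gives `k³` the coefficient `4 - 2(n + m)`:
exactly what cancels `∑ k³` and `(∑ k)²`. The root `n - 1` is needed in `linear_relation`, and it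
fixes the other one. -/
theorem sum_gapQuad_resWt (n m : ℕ) (a : ℂ) {k : Fin (n + m) → ℂ} (hk : Function.Injective k)
    (hsq : ∀ i, k i ^ 2 = kapVec n (n + m) i ^ 2) :
    ∑ i, (a + (k i + 1) ^ 2) * gapQuad n m (k i) * resWt k univ i =
      ((n : ℂ) + 2 * m + 1) * (n + 2 * m) * (∑ i, k i +
        (a + (n + 2 * m + 1) ^ 2 - 2 * ∑ i : Fin (n + m), (kap n i : ℂ)) / 2) := by
  obtain ⟨h0, h1, h2, h3, h4⟩ := resMoment_eq hk univ
  have e2 : ∑ i, k i ^ 2 = _ := (sum_congr rfl fun i _ => hsq i).trans (sum_kap_sq n m)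
  have e4 : ∑ i, k i ^ 4 = ∑ i : Fin (n + m), (kap n i : ℂ) ^ 4 := by
    refine sum_congr rfl fun i _ => ?_
    have := hsq i
    calc k i ^ 4 = (k i ^ 2) ^ 2 := by ring
      _ = (kap n i : ℂ) ^ 4 := by rw [this, kapVec]; ring
  have hexp : ∑ i, (a + (k i + 1) ^ 2) * gapQuad n m (k i) * resWt k univ i =
      resMoment k univ 4 + (4 - 2 * ((n : ℂ) + m)) * resMoment k univ 3
      + (6 - 6 * ((n : ℂ) + m) + n * (n + 2 * m) + a) * resMoment k univ 2
      + (4 - 6 * ((n : ℂ) + m) + 2 * (n * (n + 2 * m)) + 2 * a - 2 * ((n : ℂ) + m) * a)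
        * resMoment k univ 1
      + (1 + a) * (1 - 2 * ((n : ℂ) + m) + n * (n + 2 * m)) * resMoment k univ 0 := by
    simp only [resMoment, mul_sum, ← sum_add_distrib]
    refine sum_congr rfl fun i _ => ?_
    rw [gapQuad]
    ring
  rw [hexp, h0, h1, h2, h3, h4, e2, e4, sum_kap_pow_four, sum_kap]
  simp only [card_univ, Fintype.card_fin]
  push_cast
  ring

/-! ### The linear relation -/

/-- The coefficient of the growing exponential in `phi`. -/
def alph (z a : ℂ) (i : ℕ) : ℂ := -(low a i * (-z) ^ i)

/-- The coefficient of the decaying exponential in `phi`. -/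
def bet (w b : ℂ) (i : ℕ) : ℂ := low b i * w ^ i

/-- The row whose Wronskians are the polynomials `U`. -/
def phi (z w a b : ℂ) (i : ℕ) : ℕ → ℂ := solRow i (alph z a i) (bet w b i)

/-- The image of an exponential under the operator that shifts the index of `phi` by `±2`. -/
def shiftExp (n m : ℕ) (z w a b k : ℂ) : ℕ → ℂ :=
  (z ^ 2 * ((a + (k + 1) ^ 2) * gapQuad n m k)) • expRow (k + 2) +
    (w ^ 2 * ((b + (-k + 1) ^ 2) * gapQuad n m (-k))) • expRow (k - 2)

/-- The image of `phi i` under the part of the shift operator that lowers the index. -/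
def downRow (z w a b : ℂ) : ℕ → ℕ → ℂ
  | 0 => 0
  | 1 => (a * b * (z * w)) • solRow 1 z w
  | l + 2 => (bar a (l + 2) * bar b (l + 2) * (z * w) ^ 2) • phi z w a b l

theorem phi_zero (z w a b : ℂ) : phi z w a b 0 = 0 := by
  ext j
  simp [phi, solRow, alph, bet, low]

/-- The step `low a (i + 2) = low a i * bar a (i + 2)` matches the factor `a + (k + 1)²` of
`shiftExp`, so both exponentials of `phi i` move outwards to `phi (i + 2)`, while the two inward
ones form `downRow`. At `i = 1` the inward terms cross, which swaps the roles of `z` and `w` and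
leaves the new row `solRow 1 z w`. -/
theorem shift_phi (n m : ℕ) (z w a b : ℂ) {i : ℕ} (hi : 0 < i) :
    alph z a i • shiftExp n m z w a b i + bet w b i • shiftExp n m z w a b (-i) =
      gapQuad n m i • phi z w a b (i + 2) + gapQuad n m (-i) • downRow z w a b i := by
  obtain _ | _ | l := i
  · omega
  · ext j
    have h1 : (-1 : ℂ) + 2 = 1 := by norm_num
    have h2 : (1 : ℂ) - 2 = -1 := by norm_num
    have h3 : (1 : ℂ) + 2 = 3 := by norm_num
    have h4 : (-1 : ℂ) - 2 = -3 := by norm_num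
    simp [shiftExp, phi, solRow, downRow, alph, bet, low, bar, h1, h2, h3, h4]
    ring_nf
  · have h1 : -((l + 2 : ℕ) : ℂ) + 2 = -(l : ℂ) := by push_cast; ring
    have h2 : ((l + 2 : ℕ) : ℂ) - 2 = (l : ℂ) := by push_cast; ring
    have h3 : ((l + 2 : ℕ) : ℂ) + 2 = ((l + 2 + 2 : ℕ) : ℂ) := by push_cast; ring
    have h4 : -((l + 2 : ℕ) : ℂ) - 2 = -((l + 2 + 2 : ℕ) : ℂ) := by push_cast; ring
    ext j
    simp only [shiftExp, phi, solRow, downRow, alph, bet, low, bar, h1, h2, h3, h4, Pi.add_apply,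
      Pi.smul_apply, smul_eq_mul]
    generalize expRow (-((l + 2 + 2 : ℕ) : ℂ)) j = e₁
    generalize expRow ((l + 2 + 2 : ℕ) : ℂ) j = e₂
    push_cast
    ring_nf

theorem wr_update_shiftExp {N : ℕ} (n m : ℕ) (z w a b : ℂ) {k : Fin N → ℂ}
    (hk : Function.Injective k) (i : Fin N) :
    wr (Function.update (fun i => expRow (k i)) i (shiftExp n m z w a b (k i))) =
      vand k * (z ^ 2 * ((a + (k i + 1) ^ 2) * gapQuad n m (k i) * resWt k univ i) +
        w ^ 2 * ((b + (-k i + 1) ^ 2) * gapQuad n m (-k i) * resWt (-k) univ i)) := by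
  have key : ∀ x, wr (Function.update (fun i => expRow (k i)) i (expRow x)) =
      vand k * ∏ j ∈ univ.erase i, (x - k j) / (k i - k j) := by
    intro x
    rw [← vand_update hk, ← wr_expRow]
    congr 1
    ext i' j
    by_cases h : i' = i
    · subst h; simp
    · simp [h]
  rw [shiftExp, wr, wrAt_update_add, wrAt_update_smul, wrAt_update_smul]
  simp only [wr] at key
  rw [key, key]
  have h1 : ∏ j ∈ univ.erase i, (k i + 2 - k j) / (k i - k j) = resWt k univ i :=
    prod_congr rfl fun j _ => by congr 1; ring
  have h2 : ∏ j ∈ univ.erase i, (k i - 2 - k j) / (k i - k j) = resWt (-k) univ i := by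
    refine prod_congr rfl fun j _ => ?_
    rw [← neg_div_neg_eq, Pi.neg_apply, Pi.neg_apply]
    congr 1 <;> ring
  rw [h1, h2]
  ring

/-- For a fixed choice of signs, replacing exponents one at a time by `k i ± 2` gives the residue
weights of `k` and `-k`. Thus `sum_gapQuad_resWt` applies twice, once to each vector; the opposite
signs of `∑ k` give the factor `z² - w²`. -/
theorem sum_wr_update_shift (n m : ℕ) (z w a b : ℂ) (α β : Fin (n + m) → ℂ) :
    ∑ i, wr (Function.update (fun i => solRow (kapVec n (n + m) i) (α i) (β i)) i
        (α i • shiftExp n m z w a b (kapVec n (n + m) i) +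
          β i • shiftExp n m z w a b (-kapVec n (n + m) i))) =
      ((n : ℂ) + 2 * m + 1) * (n + 2 * m) * ((z ^ 2 - w ^ 2) * tau 1 (kapVec n (n + m)) α β +
        (z ^ 2 * (a + (n + 2 * m + 1) ^ 2 - 2 * ∑ i : Fin (n + m), (kap n i : ℂ)) +
          w ^ 2 * (b + (n + 2 * m + 1) ^ 2 - 2 * ∑ i : Fin (n + m), (kap n i : ℂ))) / 2 *
        tau 0 (kapVec n (n + m)) α β) := by
  set κ := kapVec n (n + m) with hκ
  have hexp : ∀ i, wr (Function.update (fun i => solRow (κ i) (α i) (β i)) i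
        (α i • shiftExp n m z w a b (κ i) + β i • shiftExp n m z w a b (-κ i))) =
      ∑ J : Finset (Fin (n + m)), ((∏ i ∈ J, α i) * ∏ i ∈ Jᶜ, β i) *
        wr (Function.update (fun i => expRow (sgnVec J κ i)) i
          (shiftExp n m z w a b (sgnVec J κ i))) := by
    intro i
    have h := wrAt_add_smul (fun j => (j : ℕ)) α β
      (Function.update (fun i => expRow (κ i)) i (shiftExp n m z w a b (κ i)))
      (Function.update (fun i => expRow (-κ i)) i (shiftExp n m z w a b (-κ i)))
    rw [wr]
    convert h using 2 with J
    · ext i' j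
      by_cases h : i' = i
      · subst h; simp
      · simp [h, solRow]
    · rw [wr]
      congr 2
      ext i' j
      by_cases h : i' = i
      · subst h
        by_cases hJ : i' ∈ J <;> simp [hJ, sgnVec]
      · by_cases hJ : i' ∈ J <;> simp [h, hJ, sgnVec]
  simp only [hexp]
  rw [sum_comm, tau, tau, mul_sum, mul_sum, ← sum_add_distrib, mul_sum]
  refine sum_congr rfl fun J _ => ?_
  have hinj : Function.Injective (sgnVec J κ) := sgnVec_injective J (kap_injective n (n + m))
  have hinj' : Function.Injective (-sgnVec J κ) := neg_injective.comp hinj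
  have g1 := sum_gapQuad_resWt n m a hinj (sgnVec_sq J κ)
  have g2 := sum_gapQuad_resWt n m b hinj' fun i => by
    rw [Pi.neg_apply, neg_sq, sgnVec_sq]
  simp only [Pi.neg_apply, sum_neg_distrib] at g2
  simp only [wr_update_shiftExp n m z w a b hinj]
  rw [← mul_sum, ← mul_sum, sum_add_distrib, ← mul_sum, ← mul_sum, g1, g2]
  ring

theorem kap_last (n m : ℕ) : kap n (n + m) = n + 2 * (m + 1) := by
  rw [kap, if_neg (by omega)]
  omega

/-- The excluded position carries the index `n - 1`, whose successor by 2 is the gap `n + 1`. -/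
theorem exists_kap_eq_add_two {n j : ℕ} (h : j + 2 ≠ n) :
    ∃ l, l ≤ j + 2 ∧ l ≠ j ∧ (n ≤ j + 1 → l ≤ j + 1) ∧ (j + 2 < n → l < n) ∧
      kap n l = kap n j + 2 := by
  by_cases hj : j + 2 < n
  · refine ⟨j + 2, by omega, by omega, by omega, by omega, ?_⟩
    rw [kap, kap, if_pos hj, if_pos (by omega)]
  · refine ⟨j + 1, by omega, by omega, by omega, by omega, ?_⟩
    unfold kap
    split_ifs <;> omega

theorem exists_kap_add_two_eq {n j : ℕ} (h : 2 < kap n j) : ∃ l < j, kap n l + 2 = kap n j := by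
  by_cases hj : j < n
  · have : 2 ≤ j := by rw [kap, if_pos hj] at h; omega
    refine ⟨j - 2, by omega, ?_⟩
    rw [kap, kap, if_pos hj, if_pos (by omega)]
    omega
  · have : 1 ≤ j := by
      unfold kap at h
      split_ifs at h
      omega
    refine ⟨j - 1, by omega, ?_⟩
    unfold kap at h ⊢
    split_ifs at h ⊢ <;> omega

/-- The linear relation between the Wronskian of `phi` on `[n;m+1]` and the Wronskians in which the
last index is raised or the first one lowered. -/
theorem linear_relation (n m : ℕ) (z w a b : ℂ) :
    (2 * m + 3 : ℂ) * wr (Function.update (fun i : Fin (n + m + 1) => phi z w a b (kap n i))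
        (Fin.last (n + m)) (phi z w a b (kap n (n + m + 1)))) +
      (n * (n + 2 * (m + 1)) * (a * b * (z * w)) : ℂ) *
        wr (Function.update (fun i : Fin (n + m + 1) => phi z w a b (kap n i)) 0 (solRow 1 z w)) =
      ((n : ℂ) + 2 * (m + 1) + 1) * (n + 2 * (m + 1)) *
        ((z ^ 2 - w ^ 2) * tau 1 (kapVec n (n + m + 1)) (fun i => alph z a (kap n i))
            (fun i => bet w b (kap n i)) +
        (z ^ 2 * (a + (n + 2 * (m + 1) + 1) ^ 2 - 2 * ∑ i : Fin (n + m + 1), (kap n i : ℂ)) +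
          w ^ 2 * (b + (n + 2 * (m + 1) + 1) ^ 2 - 2 * ∑ i : Fin (n + m + 1), (kap n i : ℂ))) / 2 *
        tau 0 (kapVec n (n + m + 1)) (fun i => alph z a (kap n i))
            (fun i => bet w b (kap n i))) := by
  have h := sum_wr_update_shift n (m + 1) z w a b (fun i => alph z a (kap n i))
            (fun i => bet w b (kap n i))
  push_cast at h
  refine Eq.trans ?_ h
  set C : Fin (n + m + 1) → ℕ → ℂ := fun i => phi z w a b (kap n i) with hC
  have hsplit : ∀ i : Fin (n + m + 1), wr (Function.update C i
        (alph z a (kap n i) • shiftExp n (m + 1) z w a b (kap n i) +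
          bet w b (kap n i) • shiftExp n (m + 1) z w a b (-(kap n i : ℂ)))) =
      gapQuad n (m + 1) (kap n i) * wr (Function.update C i (phi z w a b (kap n i + 2))) +
      gapQuad n (m + 1) (-(kap n i : ℂ)) * wr (Function.update C i
        (downRow z w a b (kap n i))) := by
    intro i
    rw [shift_phi _ _ _ _ _ _ (kap_pos n i), wr, wrAt_update_add, wrAt_update_smul,
      wrAt_update_smul]
    rfl
  have hzero : ∀ (i l : Fin (n + m + 1)), l ≠ i → wr (Function.update C i (C l)) = 0 := by
    intro i l hl
    exact wrAt_eq_zero_of_eq _ _ hl.symm (by simp [hl])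
  have hzero' : ∀ i, wr (Function.update C i 0) = 0 := by
    intro i
    have := wrAt_update_smul (fun j : Fin (n + m + 1) => (j : ℕ)) C i 0 0
    simpa [wr] using this
  have hup : ∑ i : Fin (n + m + 1), gapQuad n (m + 1) (kap n i) *
      wr (Function.update C i (phi z w a b (kap n i + 2))) =
      (2 * m + 3 : ℂ) * wr (Function.update C (Fin.last (n + m))
        (phi z w a b (kap n (n + m + 1)))) := by
    rw [sum_eq_single (Fin.last (n + m))]
    -- The last index `n + 2(m + 1)` is raised out of the set; there `gapQuad` equals `(2m + 3) ·
    -- 1`.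
    · have e1 : kap n (n + m + 1) = kap n (n + m) + 2 := by
        rw [kap_last, show n + m + 1 = n + (m + 1) from rfl, kap_last]; ring
      rw [Fin.val_last, e1, kap_last]
      congr 1
      rw [gapQuad]
      push_cast
      ring
    · intro i _ hi
      have hi' : (i : ℕ) < n + m := by
        have := Fin.val_lt_last hi
        simpa using this
      by_cases hn : (i : ℕ) + 2 = n
      · have : gapQuad n (m + 1) (kap n i) = 0 := by
          rw [gapQuad, kap, if_pos (by omega)]
          have : (n : ℂ) = (i : ℕ) + 2 := by exact_mod_cast hn.symm
          rw [this]
          push_cast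
          ring
        rw [this, zero_mul]
      · obtain ⟨l, -, hl1, hl2, hl3, hl⟩ := exists_kap_eq_add_two hn
        have hlt : l < n + m + 1 := by omega
        rw [← hl]
        have := hzero i ⟨l, hlt⟩ (fun h => hl1 (by rw [← h]))
        rw [hC] at this ⊢
        rw [this, mul_zero]
    · simp
  have hdown : ∑ i : Fin (n + m + 1), gapQuad n (m + 1) (-(kap n i : ℂ)) *
      wr (Function.update C i (downRow z w a b (kap n i))) =
      (n * (n + 2 * (m + 1)) * (a * b * (z * w)) : ℂ) *
        wr (Function.update C 0 (solRow 1 z w)) := by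
    have hone : ∀ i : Fin (n + m + 1), kap n i ≠ 1 →
        wr (Function.update C i (downRow z w a b (kap n i))) = 0 := by
      intro i hi
      have hpos := kap_pos n i
      obtain hk | hk : kap n i = 2 ∨ 2 < kap n i := by omega
      · rw [hk, downRow, phi_zero, smul_zero, hzero']
      · obtain ⟨l, hl, hkl⟩ := exists_kap_add_two_eq hk
        rw [← hkl, downRow, wr, wrAt_update_smul]
        have := hzero i ⟨l, by omega⟩ (fun h => hl.ne (by rw [← h]))
        rw [hC, wr] at this
        rw [hC, this, mul_zero]
    rw [sum_eq_single 0]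
    · by_cases hn : n = 0
      · rw [hone 0 (by simp [kap, hn])]
        simp [hn]
      · have : kap n ((0 : Fin (n + m + 1)) : ℕ) = 1 := by
          rw [Fin.val_zero, kap, if_pos (by omega)]
        rw [this, downRow, wr, wrAt_update_smul, gapQuad, wr]
        push_cast
        ring
    · intro i _ hi
      rw [hone i, mul_zero]
      intro h1
      have := (kap_strictMono n) (Fin.pos_of_ne_zero hi)
      have := kap_pos n ((0 : Fin (n + m + 1)) : ℕ)
      omega
    · simp
  rw [← hup, ← hdown, ← sum_add_distrib]
  exact sum_congr rfl fun i _ => (hsplit i).symm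

/-! ### Differentiation along `z ∂_z - w ∂_w` -/

theorem sum_sgnVec {N : ℕ} (J : Finset (Fin N)) (κ : Fin N → ℂ) :
    ∑ i, sgnVec J κ i = ∑ i ∈ J, κ i - ∑ i ∈ Jᶜ, κ i := by
  rw [sgnVec, sum_piecewise]
  simp [compl_eq_univ_sdiff, sub_eq_add_neg]

/-- The term of `J` is multiplied by `exp` of `t` times its signed exponent sum, so one
differentiation adds one power of that sum. -/
theorem hasDerivAt_tau {N : ℕ} (r : ℕ) (κ α β : Fin N → ℂ) :
    HasDerivAt (fun t : ℂ => tau r κ (fun i => α i * Complex.exp (κ i * t))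
      (fun i => β i * Complex.exp (-(κ i * t)))) (tau (r + 1) κ α β) 0 := by
  have hexp : ∀ t : ℂ, tau r κ (fun i => α i * Complex.exp (κ i * t))
      (fun i => β i * Complex.exp (-(κ i * t))) =
      ∑ J : Finset (Fin N), ((∏ i ∈ J, α i) * ∏ i ∈ Jᶜ, β i) *
        (vand (sgnVec J κ) * (∑ i, sgnVec J κ i) ^ r) *
        Complex.exp ((∑ i, sgnVec J κ i) * t) := by
    intro t
    refine sum_congr rfl fun J _ => ?_
    have : Complex.exp ((∑ i, sgnVec J κ i) * t) =
        (∏ i ∈ J, Complex.exp (κ i * t)) * ∏ i ∈ Jᶜ, Complex.exp (-(κ i * t)) := by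
      rw [← Complex.exp_sum, ← Complex.exp_sum, ← Complex.exp_add, sum_sgnVec, sum_neg_distrib,
        ← sum_mul, ← sum_mul]
      congr 1
      ring
    rw [this, prod_mul_distrib, prod_mul_distrib]
    ring
  simp only [hexp]
  refine (HasDerivAt.fun_sum (A' := fun J : Finset (Fin N) => ((∏ i ∈ J, α i) * ∏ i ∈ Jᶜ, β i) *
    (vand (sgnVec J κ) * (∑ i, sgnVec J κ i) ^ (r + 1))) fun J _ => ?_)
  have h1 : HasDerivAt (fun t : ℂ => (∑ i, sgnVec J κ i) * t) (∑ i, sgnVec J κ i) 0 := by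
    simpa using (hasDerivAt_id (0 : ℂ)).const_mul (∑ i, sgnVec J κ i)
  have h2 := h1.cexp.const_mul (((∏ i ∈ J, α i) * ∏ i ∈ Jᶜ, β i) *
        (vand (sgnVec J κ) * (∑ i, sgnVec J κ i) ^ r))
  refine h2.congr_deriv ?_
  rw [mul_zero, Complex.exp_zero]
  ring

theorem alph_mul_exp (z a t : ℂ) (i : ℕ) :
    alph (z * Complex.exp t) a i = alph z a i * Complex.exp (i * t) := by
  rw [alph, alph, Complex.exp_nat_mul, neg_mul_eq_neg_mul z, mul_pow]
  ring

theorem bet_mul_exp (w b t : ℂ) (i : ℕ) :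
    bet (w * Complex.exp (-t)) b i = bet w b i * Complex.exp (-(i * t)) := by
  rw [bet, bet, ← mul_neg, Complex.exp_nat_mul, mul_pow]
  ring

/-- The expansion moments of the Wronskian of `phi` on the first `N` indices. -/
def tauU (n N r : ℕ) (z w a b : ℂ) : ℂ :=
  tau r (kapVec n N) (fun i => alph z a (kap n i)) (fun i => bet w b (kap n i))

theorem wr_phi (n N : ℕ) (z w a b : ℂ) :
    wr (fun i : Fin N => phi z w a b (kap n i)) = tauU n N 0 z w a b :=
  wr_solRow _ _ _

theorem wrD_phi (n N : ℕ) (z w a b : ℂ) :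
    wrD (fun i : Fin (N + 1) => phi z w a b (kap n i)) = tauU n (N + 1) 1 z w a b :=
  wrD_solRow _ _ _

theorem hasDerivAt_tauU (n N r : ℕ) (z w a b : ℂ) :
    HasDerivAt (fun t : ℂ => tauU n N r (z * Complex.exp t) (w * Complex.exp (-t)) a b)
      (tauU n N (r + 1) z w a b) 0 := by
  simp only [tauU, alph_mul_exp, bet_mul_exp]
  exact hasDerivAt_tau r (kapVec n N) _ _

theorem hasDerivAt_wr_raised (n N : ℕ) (z w a b : ℂ) :
    HasDerivAt (fun t : ℂ => wr (Function.update
        (fun i : Fin (N + 1) => phi (z * Complex.exp t) (w * Complex.exp (-t)) a b (kap n i))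
        (Fin.last N) (phi (z * Complex.exp t) (w * Complex.exp (-t)) a b (kap n (N + 1)))))
      (wrD (Function.update (fun i : Fin (N + 1) => phi z w a b (kap n i)) (Fin.last N)
        (phi z w a b (kap n (N + 1))))) 0 := by
  set ν : Fin (N + 1) → ℕ := Function.update (fun i : Fin (N + 1) => kap n i) (Fin.last N)
    (kap n (N + 1)) with hν
  have hupd : ∀ z w : ℂ, Function.update (fun i : Fin (N + 1) => phi z w a b (kap n i))
      (Fin.last N) (phi z w a b (kap n (N + 1))) =
      fun i => solRow (ν i) (alph z a (ν i)) (bet w b (ν i)) := by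
    intro z w
    ext i j
    by_cases h : i = Fin.last N
    · subst h; simp [hν, phi]
    · simp [hν, h, phi]
  simp only [hupd, wr_solRow, wrD_solRow, alph_mul_exp, bet_mul_exp]
  exact hasDerivAt_tau 0 (fun i => (ν i : ℂ)) _ _

theorem hasDerivAt_wr_lowered (n N : ℕ) (z w a b : ℂ) :
    HasDerivAt (fun t : ℂ => wr (Function.update
        (fun i : Fin (N + 1) => phi (z * Complex.exp t) (w * Complex.exp (-t)) a b (kap n i))
        0 (solRow 1 (z * Complex.exp t) (w * Complex.exp (-t)))))
      (wrD (Function.update (fun i : Fin (N + 1) => phi z w a b (kap n i)) 0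
        (solRow 1 z w))) 0 := by
  set ν : Fin (N + 1) → ℕ := Function.update (fun i : Fin (N + 1) => kap n i) 0 1 with hν
  set A : ℂ → Fin (N + 1) → ℂ := fun z =>
    Function.update (fun i : Fin (N + 1) => alph z a (kap n i)) 0 z with hA
  set B : ℂ → Fin (N + 1) → ℂ := fun w =>
    Function.update (fun i : Fin (N + 1) => bet w b (kap n i)) 0 w with hB
  have hupd : ∀ z w : ℂ, Function.update (fun i : Fin (N + 1) => phi z w a b (kap n i))
      0 (solRow 1 z w) = fun i => solRow (ν i) (A z i) (B w i) := by
    intro z w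
    ext i j
    by_cases h : i = 0
    · subst h; simp [hν, hA, hB]
    · simp [hν, hA, hB, h, phi]
  have hA' : ∀ t, A (z * Complex.exp t) = fun i => A z i * Complex.exp (ν i * t) := by
    intro t
    ext i
    by_cases h : i = 0
    · subst h; simp [hν, hA]
    · simp [hν, hA, h, alph_mul_exp]
  have hB' : ∀ t, B (w * Complex.exp (-t)) = fun i => B w i * Complex.exp (-(ν i * t)) := by
    intro t
    ext i
    by_cases h : i = 0
    · subst h; simp [hν, hB]
    · simp [hν, hB, h, bet_mul_exp]
  simp only [hupd, wr_solRow, wrD_solRow, hA', hB']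
  exact hasDerivAt_tau 0 (fun i => (ν i : ℂ)) _ _

/-! ### Wronskians containing `exp t` and `exp (-t)` -/

/-- Subtracting `μ` times the preceding column turns the exponential row into `(1, 0, …, 0)` and
applies `d/dt - μ` to the remaining rows. -/
theorem wr_cons_expRow {N : ℕ} (μ : ℂ) (Q : Fin N → ℕ → ℂ) :
    wr (Fin.cons (expRow μ) Q : Fin (N + 1) → ℕ → ℂ) =
      wr (fun i j => Q i (j + 1) - μ * Q i j) := by
  set C : Fin (N + 1) → ℕ → ℂ := Fin.cons (expRow μ) Q with hC
  set B : Matrix (Fin (N + 1)) (Fin (N + 1)) ℂ := Matrix.of fun i j =>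
    Fin.cases (C i 0) (fun l : Fin N => C i (l + 1) - μ * C i l) j with hB
  have h1 : (Matrix.of fun i (j : Fin (N + 1)) => C i j).det = B.det := by
    refine Matrix.det_eq_of_forall_col_eq_smul_add_pred (fun _ => μ) ?_ ?_
    · intro i; simp [hB]
    · intro i j; simp [hB]
  rw [wr, wrAt, h1, Matrix.det_succ_row_zero, sum_eq_single 0]
  · simp only [Fin.val_zero, pow_zero, one_mul]
    have : B 0 0 = 1 := by simp [hB, hC, expRow]
    rw [this, one_mul, wr, wrAt]
    congr 1
  · intro j _ hj
    obtain ⟨l, rfl⟩ := Fin.exists_succ_eq.2 hj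
    have : B 0 l.succ = 0 := by
      simp [hB, hC, expRow, pow_succ, mul_comm]
    rw [this]
    ring
  · simp

theorem wr_cons_add {N : ℕ} (Q : Fin N → ℕ → ℂ) (x y : ℕ → ℂ) :
    wr (Fin.cons (x + y) Q : Fin (N + 1) → ℕ → ℂ) =
      wr (Fin.cons x Q : Fin (N + 1) → ℕ → ℂ) + wr (Fin.cons y Q : Fin (N + 1) → ℕ → ℂ) := by
  have := wrAt_update_add (fun j => (j : ℕ)) (Fin.cons x Q : Fin (N + 1) → ℕ → ℂ) 0 x y
  simpa [Fin.update_cons_zero, wr] using this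

theorem wr_cons_smul {N : ℕ} (Q : Fin N → ℕ → ℂ) (c : ℂ) (x : ℕ → ℂ) :
    wr (Fin.cons (c • x) Q : Fin (N + 1) → ℕ → ℂ) =
      c * wr (Fin.cons x Q : Fin (N + 1) → ℕ → ℂ) := by
  have := wrAt_update_smul (fun j => (j : ℕ)) (Fin.cons x Q : Fin (N + 1) → ℕ → ℂ) 0 c x
  simpa [Fin.update_cons_zero, wr] using this

theorem wr_cons_cons_self {N : ℕ} (Q : Fin N → ℕ → ℂ) (x : ℕ → ℂ) :
    wr (Fin.cons x (Fin.cons x Q : Fin (N + 1) → ℕ → ℂ) : Fin (N + 2) → ℕ → ℂ) = 0 :=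
  wrAt_eq_zero_of_eq _ _ (i := 0) (j := 1) (by simp) (by
    rw [← Fin.succ_zero_eq_one, Fin.cons_succ, Fin.cons_zero, Fin.cons_zero])

theorem update_cons_cons_one {N : ℕ} (Q : Fin N → ℕ → ℂ) (x y y' : ℕ → ℂ) :
    Function.update (Fin.cons x (Fin.cons y Q : Fin (N + 1) → ℕ → ℂ) : Fin (N + 2) → ℕ → ℂ) 1 y' =
      Fin.cons x (Fin.cons y' Q : Fin (N + 1) → ℕ → ℂ) := by
  rw [← Fin.succ_zero_eq_one, ← Fin.cons_update, Fin.update_cons_zero]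

theorem wr_cons_cons_add {N : ℕ} (Q : Fin N → ℕ → ℂ) (x y y' : ℕ → ℂ) :
    wr (Fin.cons x (Fin.cons (y + y') Q : Fin (N + 1) → ℕ → ℂ) : Fin (N + 2) → ℕ → ℂ) =
      wr (Fin.cons x (Fin.cons y Q : Fin (N + 1) → ℕ → ℂ) : Fin (N + 2) → ℕ → ℂ) +
      wr (Fin.cons x (Fin.cons y' Q : Fin (N + 1) → ℕ → ℂ) : Fin (N + 2) → ℕ → ℂ) := by
  have h := wrAt_update_add (fun j => (j : ℕ)) (Fin.cons x
    (Fin.cons y Q : Fin (N + 1) → ℕ → ℂ) : Fin (N + 2) → ℕ → ℂ) 1 y y'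
  simp only [update_cons_cons_one] at h
  exact h

theorem wr_cons_cons_smul {N : ℕ} (Q : Fin N → ℕ → ℂ) (c : ℂ) (x y : ℕ → ℂ) :
    wr (Fin.cons x (Fin.cons (c • y) Q : Fin (N + 1) → ℕ → ℂ) : Fin (N + 2) → ℕ → ℂ) =
      c * wr (Fin.cons x (Fin.cons y Q : Fin (N + 1) → ℕ → ℂ) : Fin (N + 2) → ℕ → ℂ) := by
  have h := wrAt_update_smul (fun j => (j : ℕ)) (Fin.cons x
    (Fin.cons y Q : Fin (N + 1) → ℕ → ℂ) : Fin (N + 2) → ℕ → ℂ) 1 c y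
  simp only [update_cons_cons_one] at h
  exact h

theorem wr_snoc_snoc {N : ℕ} (S : Fin N → ℕ → ℂ) (x y : ℕ → ℂ) :
    wr (Fin.snoc (Fin.snoc S x : Fin (N + 1) → ℕ → ℂ) y : Fin (N + 2) → ℕ → ℂ) =
      wr (Fin.cons x (Fin.cons y S : Fin (N + 1) → ℕ → ℂ) : Fin (N + 2) → ℕ → ℂ) := by
  have h1 := wrAt_cons (fun j => (j : ℕ)) (Fin.snoc S x : Fin (N + 1) → ℕ → ℂ) y
  have h2 := wrAt_cons (fun j => (j : ℕ)) (Fin.cons y S : Fin (N + 1) → ℕ → ℂ) x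
  rw [← Fin.cons_snoc_eq_snoc_cons] at h2
  have h3 : ((-1 : ℂ) ^ (N + 1)) * (-1) ^ (N + 1) = 1 := by rw [← mul_pow]; simp
  rw [wr, wr, h2, h1, ← mul_assoc, h3, one_mul]

/-- The determinant is alternating in its first two rows, both in the span of `e^t` and `e^{-t}`, so
it reduces to that pair. Splitting these off applies `d²/dt² - 1` to the other rows, which
multiplies `solRow κ` by `κ² - 1`. -/
theorem wr_cons_solRow_cons_solRow {N : ℕ} (κ α β : Fin N → ℂ) (c₁ d₁ c₂ d₂ : ℂ) :
    wr (Fin.cons (solRow 1 c₁ d₁) (Fin.cons (solRow 1 c₂ d₂)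
      (fun i => solRow (κ i) (α i) (β i)) : Fin (N + 1) → ℕ → ℂ) : Fin (N + 2) → ℕ → ℂ) =
      -2 * (c₁ * d₂ - d₁ * c₂) * (∏ i, (κ i ^ 2 - 1)) *
        wr (fun i => solRow (κ i) (α i) (β i)) := by
  set Q : Fin N → ℕ → ℂ := fun i => solRow (κ i) (α i) (β i) with hQ
  set B : (ℕ → ℂ) → (ℕ → ℂ) → ℂ := fun x y =>
    wr (Fin.cons x (Fin.cons y Q : Fin (N + 1) → ℕ → ℂ) : Fin (N + 2) → ℕ → ℂ) with hB
  have hadd : ∀ x x' y, B (x + x') y = B x y + B x' y := fun x x' y => wr_cons_add _ _ _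
  have hsmul : ∀ c x y, B (c • x) y = c * B x y := fun c x y => wr_cons_smul _ _ _
  have hself : ∀ x, B x x = 0 := fun x => wr_cons_cons_self _ _
  have hadd' : ∀ x y y', B x (y + y') = B x y + B x y' := fun x y y' => wr_cons_cons_add _ _ _ _
  have hsmul' : ∀ c x y, B x (c • y) = c * B x y := fun c x y => wr_cons_cons_smul _ _ _ _
  have hneg : B (expRow 1) (expRow (-1)) = -2 * (∏ i, (κ i ^ 2 - 1)) * wr Q := by
    have hrow : (fun (i : Fin (N + 1)) j => (Fin.cons (expRow (-1)) Q : Fin (N + 1) → ℕ → ℂ) i (j + 1)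
        - 1 * (Fin.cons (expRow (-1)) Q : Fin (N + 1) → ℕ → ℂ) i j) =
        Fin.cons ((-2 : ℂ) • expRow (-1)) fun i j => Q i (j + 1) - Q i j := by
      ext i j
      refine Fin.cases ?_ (fun i => ?_) i
      · simp [expRow, pow_succ]
        ring
      · simp
    simp only [hB]
    rw [wr_cons_expRow, hrow, wr_cons_smul, wr_cons_expRow, mul_assoc]
    congr 1
    rw [wr, wr, ← wrAt_smul]
    congr 1
    ext i j
    simp [hQ, solRow, expRow]
    ring
  have hswap : B (expRow (-1)) (expRow 1) = -B (expRow 1) (expRow (-1)) := by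
    have h := hself (expRow 1 + expRow (-1))
    rw [hadd, hadd', hadd', hself, hself] at h
    linear_combination h
  change B (c₁ • expRow 1 + d₁ • expRow (-1)) (c₂ • expRow 1 + d₂ • expRow (-1)) = _
  rw [hadd, hsmul, hsmul, hadd', hadd', hsmul', hsmul', hsmul', hsmul', hself, hself, hswap, hneg]
  ring

/-! ### The bilinear relation -/

theorem fun_eq_snoc {α : Type*} (g : ℕ → α) (N : ℕ) :
    (fun i : Fin (N + 1) => g i) = Fin.snoc (fun i : Fin N => g i) (g N) := by
  ext i
  refine Fin.lastCases ?_ (fun i => ?_) i <;> simp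

theorem fun_eq_cons {α : Type*} (g : ℕ → α) (N : ℕ) :
    (fun i : Fin (N + 1) => g i) = Fin.cons (g 0) (fun i : Fin N => g (i + 1)) := by
  ext i
  refine Fin.cases ?_ (fun i => ?_) i <;> simp

theorem phi_one (z w a b : ℂ) : phi z w a b 1 = solRow 1 (a * z) (b * w) := by
  simp [phi, alph, bet, low, bar]

theorem jacobi_raised (n N : ℕ) (z w a b : ℂ) :
    tauU n (N + 1) 0 z w a b * wrD (Function.update (fun i : Fin (N + 1) => phi z w a b (kap n i))
        (Fin.last N) (phi z w a b (kap n (N + 1)))) -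
      tauU n (N + 1) 1 z w a b * wr (Function.update (fun i : Fin (N + 1) => phi z w a b (kap n i))
        (Fin.last N) (phi z w a b (kap n (N + 1)))) =
      tauU n N 0 z w a b * tauU n (N + 2) 0 z w a b := by
  have h := jacobi_wr (fun i : Fin N => phi z w a b (kap n i)) (phi z w a b (kap n N))
    (phi z w a b (kap n (N + 1)))
  have e1 := fun_eq_snoc (fun i => phi z w a b (kap n i)) N
  have e2 := fun_eq_snoc (fun i => phi z w a b (kap n i)) (N + 1)
  rw [← wr_phi, ← wr_phi, ← wr_phi, ← wrD_phi, e2, e1, Fin.update_snoc_last]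
  exact h

theorem jacobi_lowered {n : ℕ} (hn : 0 < n) (N : ℕ) (z w a b : ℂ) :
    tauU n (N + 1) 0 z w a b * wrD (Function.update (fun i : Fin (N + 1) => phi z w a b (kap n i))
        0 (solRow 1 z w)) -
      tauU n (N + 1) 1 z w a b * wr (Function.update (fun i : Fin (N + 1) => phi z w a b (kap n i))
        0 (solRow 1 z w)) =
      -2 * (z * w * (a - b)) * (∏ i : Fin N, ((kap n (i + 1) : ℂ) ^ 2 - 1)) *
        wr (fun i : Fin N => phi z w a b (kap n (i + 1))) ^ 2 := by
  have h := jacobi_wr_cons (fun i : Fin N => phi z w a b (kap n (i + 1))) (phi z w a b (kap n 0))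
    (solRow 1 z w)
  have e1 := fun_eq_cons (fun i => phi z w a b (kap n i)) N
  have hk : kap n 0 = 1 := by rw [kap, if_pos hn]
  have h2 := wr_cons_solRow_cons_solRow (fun i : Fin N => (kap n (i + 1) : ℂ))
    (fun i => alph z a (kap n (i + 1))) (fun i => bet w b (kap n (i + 1))) (a * z) (b * w) z w
  rw [← wr_phi, ← wrD_phi, e1, Fin.update_cons_zero, h, wr_snoc_snoc, hk, phi_one]
  simp only [phi]
  rw [h2]
  ring

theorem bilinear_relation (n m : ℕ) (z w a b : ℂ) :
    (2 * m + 3 : ℂ) * (tauU n (n + m) 0 z w a b * tauU n (n + m + 2) 0 z w a b) +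
      (n * (n + 2 * (m + 1)) * (a * b * (z * w)) : ℂ) *
        (-2 * (z * w * (a - b)) * (∏ i : Fin (n + m), ((kap n (i + 1) : ℂ) ^ 2 - 1)) *
        wr (fun i : Fin (n + m) => phi z w a b (kap n (i + 1))) ^ 2) =
      ((n : ℂ) + 2 * (m + 1) + 1) * (n + 2 * (m + 1)) *
        ((z ^ 2 - w ^ 2) * (tauU n (n + m + 1) 0 z w a b * tauU n (n + m + 1) 2 z w a b -
            tauU n (n + m + 1) 1 z w a b ^ 2) +
          2 * (z ^ 2 + w ^ 2) * (tauU n (n + m + 1) 0 z w a b * tauU n (n + m + 1) 1 z w a b) +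
          (z ^ 2 * (a + (n + 2 * (m + 1) + 1) ^ 2 - 2 * ∑ i : Fin (n + m + 1), (kap n i : ℂ)) -
            w ^ 2 * (b + (n + 2 * (m + 1) + 1) ^ 2 - 2 * ∑ i : Fin (n + m + 1), (kap n i : ℂ))) *
            tauU n (n + m + 1) 0 z w a b ^ 2) := by
  set d : ℂ := ∑ i : Fin (n + m + 1), (kap n i : ℂ) with hd
  have hlin := fun z w => linear_relation n m z w a b
  have hderL := ((hasDerivAt_wr_raised n (n + m) z w a b).const_mul (2 * m + 3 : ℂ)).add
    ((hasDerivAt_wr_lowered n (n + m) z w a b).const_mul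
      (n * (n + 2 * (m + 1)) * (a * b * (z * w)) : ℂ))
  have hz : HasDerivAt (fun t : ℂ => (z * Complex.exp t) ^ 2) (2 * z ^ 2) 0 := by
    have h := (((Complex.hasDerivAt_exp 0).const_mul z).pow 2)
    refine h.congr_deriv ?_
    simp
    ring
  have hw : HasDerivAt (fun t : ℂ => (w * Complex.exp (-t)) ^ 2) (-(2 * w ^ 2)) 0 := by
    have h := ((((hasDerivAt_id (0 : ℂ)).neg.cexp).const_mul w).pow 2)
    refine h.congr_deriv ?_
    simp
    ring
  have hzw : ∀ t : ℂ, z * Complex.exp t * (w * Complex.exp (-t)) = z * w := by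
    intro t
    have : Complex.exp t * Complex.exp (-t) = 1 := by rw [← Complex.exp_add]; simp
    linear_combination z * w * this
  have hderR := (((hz.sub hw).mul (hasDerivAt_tauU n (n + m + 1) 1 z w a b)).add
    ((((hz.mul_const (a + ((n : ℂ) + 2 * (m + 1) + 1) ^ 2 - 2 * d)).add
      (hw.mul_const (b + ((n : ℂ) + 2 * (m + 1) + 1) ^ 2 - 2 * d))).div_const 2).mul
      (hasDerivAt_tauU n (n + m + 1) 0 z w a b))).const_mul
      (((n : ℂ) + 2 * (m + 1) + 1) * (n + 2 * (m + 1)))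
  -- This is `D` of the linear relation, which holds for all `z, w` and hence along `(z e^t, w
  -- e^{-t})`. The product `zw` in the coefficient of the lowered term is constant there.
  have hfun := hderL.unique (hderR.congr_of_eventuallyEq (Filter.Eventually.of_forall fun t => by
    have := hlin (z * Complex.exp t) (w * Complex.exp (-t))
    rw [hzw] at this
    exact this))
  have h0 := hlin z w
  rw [← tauU, ← tauU] at h0
  simp only [Complex.exp_zero, neg_zero, mul_one, Pi.add_apply, Pi.sub_apply] at hfun
  have hup := jacobi_raised n (n + m) z w a b
  -- The factor `n` admits the case `n = 0`, where 1 is not an index and `jacobi_lowered` is not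
  -- available.
  have hK : (n : ℂ) * (tauU n (n + m + 1) 0 z w a b * wrD (Function.update
        (fun i : Fin (n + m + 1) => phi z w a b (kap n i)) 0 (solRow 1 z w)) -
      tauU n (n + m + 1) 1 z w a b * wr (Function.update
        (fun i : Fin (n + m + 1) => phi z w a b (kap n i)) 0 (solRow 1 z w))) =
      (n : ℂ) * (-2 * (z * w * (a - b)) * (∏ i : Fin (n + m), ((kap n (i + 1) : ℂ) ^ 2 - 1)) *
        wr (fun i : Fin (n + m) => phi z w a b (kap n (i + 1))) ^ 2) := by
    rcases Nat.eq_zero_or_pos n with hn | hn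
    · simp [hn]
    · rw [jacobi_lowered hn]
  linear_combination tauU n (n + m + 1) 0 z w a b * hfun - tauU n (n + m + 1) 1 z w a b * h0
    - (2 * m + 3 : ℂ) * hup - (n + 2 * (m + 1)) * (a * b * (z * w)) * hK

/-! ### Vandermonde products with signs -/

/-- The absolute ratio `|(i+j)/(i-j)|`. -/
def absRatio (i j : ℕ) : ℚ := |((i : ℚ) + j) / ((i : ℚ) - j)|

theorem absRatio_comm (i j : ℕ) : absRatio i j = absRatio j i := by
  rw [absRatio, absRatio, abs_div, abs_div, abs_sub_comm, add_comm]

theorem absRatio_of_lt {i j : ℕ} (h : i < j) : absRatio i j = ((i : ℚ) + j) / ((j : ℚ) - i) := by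
  have h' : (0 : ℚ) < (j : ℚ) - i := sub_pos.2 (by exact_mod_cast h)
  rw [absRatio, abs_div, abs_sub_comm, abs_of_pos h', abs_of_nonneg (by positivity)]

theorem vand_eq_prod {N : ℕ} (v : Fin N → ℂ) : vand v = ∏ i : Fin N, ∏ j ∈ Ioi i, (v j - v i) :=
  Matrix.det_vandermonde v

/-- Compare pair by pair with all signs negative. For `i < j`, the factor changes sign exactly when
`j ∈ J`, giving `(-1)^j` for each `j ∈ J`, and acquires `absRatio` exactly when one of the two lies
in `J`. -/
theorem vand_sgnVec {N : ℕ} {ν : Fin N → ℕ} (hν : StrictMono ν) (J : Finset (Fin N)) :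
    vand (sgnVec J fun i => (ν i : ℂ)) = vand (fun i => -(ν i : ℂ)) *
      ((∏ j ∈ J, (-1 : ℂ) ^ (j : ℕ)) * ∏ i ∈ J, ∏ j ∈ Jᶜ, (absRatio (ν i) (ν j) : ℂ)) := by
  set t : Fin N → Fin N → ℂ := fun j i => if i ∈ J ∧ j ∉ J then (absRatio (ν i) (ν j) : ℂ) else 1
    with ht
  have h1 : ∏ i ∈ J, ∏ j ∈ Jᶜ, (absRatio (ν i) (ν j) : ℂ) =
      ∏ i : Fin N, ∏ j ∈ Ioi i, t j i * t i j := by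
    rw [prod_prod_Ioi_mul_eq_prod_prod_off_diag]
    have h2 : ∀ i, ∏ j ∈ ({i}ᶜ : Finset (Fin N)), t j i = ∏ j, t j i := by
      intro i
      rw [← prod_mul_prod_compl {i} fun j => t j i]
      simp [ht]
    rw [prod_congr rfl fun i _ => h2 i, ← prod_subset (subset_univ J)]
    · refine prod_congr rfl fun i hi => ?_
      rw [← prod_subset (subset_univ Jᶜ)]
      · exact prod_congr rfl fun j hj => by simp [ht, hi, mem_compl.1 hj]
      · intro j _ hj
        have : j ∈ J := by simpa using hj
        simp [ht, this]
    · intro i _ hi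
      simp [ht, hi]
  have h3 : ∏ j ∈ J, (-1 : ℂ) ^ (j : ℕ) =
      ∏ i : Fin N, ∏ j ∈ Ioi i, (if j ∈ J then (-1 : ℂ) else 1) := by
    rw [prod_comm' (t' := univ) (s' := fun j => Iio j) (by simp)]
    rw [← prod_subset (subset_univ J)]
    · exact prod_congr rfl fun j hj => by simp [hj]
    · intro j _ hj
      simp [hj]
  rw [h1, h3, vand_eq_prod, vand_eq_prod, ← prod_mul_distrib, ← prod_mul_distrib]
  refine prod_congr rfl fun i _ => ?_
  rw [← prod_mul_distrib, ← prod_mul_distrib]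
  refine prod_congr rfl fun j hj => ?_
  have hlt : ν i < ν j := hν (mem_Ioi.1 hj)
  have hne : (ν j : ℂ) - ν i ≠ 0 := sub_ne_zero.2 (by exact_mod_cast hlt.ne')
  have hr : ((absRatio (ν i) (ν j) : ℚ) : ℂ) = ((ν i : ℂ) + ν j) / (ν j - ν i) := by
    rw [absRatio_of_lt hlt]; push_cast; rfl
  have hr' : ((absRatio (ν j) (ν i) : ℚ) : ℂ) = ((ν i : ℂ) + ν j) / (ν j - ν i) := by
    rw [absRatio_comm, hr]
  by_cases hi : i ∈ J <;> by_cases hj' : j ∈ J <;> simp [ht, hi, hj', sgnVec, hr, hr'] <;>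
    field_simp <;> ring

theorem vand_cons {N : ℕ} (x : ℂ) (v : Fin N → ℂ) :
    vand (Fin.cons x v : Fin (N + 1) → ℂ) = (∏ i, (v i - x)) * vand v := by
  rw [vand_eq_prod, vand_eq_prod, Fin.prod_univ_succ]
  simp [Fin.prod_Ioi_succ]

theorem vand_snoc {N : ℕ} (x : ℂ) (v : Fin N → ℂ) :
    vand (Fin.snoc v x : Fin (N + 1) → ℂ) = (∏ i, (x - v i)) * vand v := by
  have h := wrAt_cons (fun j => (j : ℕ)) (fun i => expRow (v i)) (expRow x)
  have h1 : (Fin.cons (expRow x) (fun i => expRow (v i)) : Fin (N + 1) → ℕ → ℂ) =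
      fun i => expRow ((Fin.cons x v : Fin (N + 1) → ℂ) i) := by
    ext i j
    refine Fin.cases ?_ (fun i => ?_) i <;> simp
  have h2 : (Fin.snoc (fun i => expRow (v i)) (expRow x) : Fin (N + 1) → ℕ → ℂ) =
      fun i => expRow ((Fin.snoc v x : Fin (N + 1) → ℂ) i) := by
    ext i j
    refine Fin.lastCases ?_ (fun i => ?_) i <;> simp
  rw [h1, h2] at h
  change vand _ = _ * vand _ at h
  rw [vand_cons] at h
  have h3 : ∏ i, (x - v i) = (-1) ^ N * ∏ i, (v i - x) := by
    have : ∀ i, x - v i = (-1) * (v i - x) := fun i => by ring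
    rw [prod_congr rfl fun i _ => this i, prod_mul_distrib]
    simp
  have h4 : ((-1 : ℂ) ^ N) * (-1) ^ N = 1 := by rw [← mul_pow]; simp
  rw [h3, mul_assoc, h, ← mul_assoc, h4, one_mul]

/-- The Vandermonde product of the negated indices. -/
def vandNeg (n N : ℕ) : ℂ := vand fun i : Fin N => -(kap n i : ℂ)

theorem vandNeg_ne_zero (n N : ℕ) : vandNeg n N ≠ 0 := by
  refine Matrix.det_vandermonde_ne_zero_iff.2 fun i j h => kap_injective n N ?_
  exact_mod_cast neg_injective h

theorem vandNeg_succ (n N : ℕ) :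
    vandNeg n (N + 1) = (∏ i : Fin N, ((kap n i : ℂ) - kap n N)) * vandNeg n N := by
  rw [vandNeg, fun_eq_snoc (fun i => -(kap n i : ℂ)), vand_snoc, vandNeg]
  congr 1
  exact prod_congr rfl fun i _ => by ring

theorem prod_range_kap (n m : ℕ) (f : ℕ → ℂ) :
    ∏ i : Fin (n + m), f (kap n i) =
      (∏ j ∈ range n, f (j + 1)) * ∏ j ∈ range m, f (n + 2 * (j + 1)) := by
  rw [Fin.prod_univ_eq_prod_range (fun j => f (kap n j)), prod_range_add]
  congr 1
  · exact prod_congr rfl fun j hj => by rw [kap, if_pos (mem_range.1 hj)]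
  · refine prod_congr rfl fun j _ => ?_
    rw [kap, if_neg (by omega)]
    congr 2
    omega

theorem prod_kap_sub (n m : ℕ) :
    ∏ i : Fin (n + m), ((kap n i : ℂ) - kap n (n + m)) =
      (∏ j ∈ range n, (-(2 * m + 2 + j : ℂ))) * ∏ j ∈ range m, (2 * ((j : ℂ) - m)) := by
  rw [prod_range_kap n m fun x => (x : ℂ) - kap n (n + m), kap_last]
  congr 1
  · rw [← prod_range_reflect]
    refine prod_congr rfl fun j hj => ?_
    have : n - 1 - j + 1 + j = n := by have := mem_range.1 hj; omega
    have h : ((n - 1 - j + 1 : ℕ) : ℂ) = n - j := by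
      rw [eq_sub_iff_add_eq]; exact_mod_cast this
    rw [h]
    push_cast
    ring
  · refine prod_congr rfl fun j _ => ?_
    push_cast
    ring

theorem prod_kap_sub_succ (n m : ℕ) :
    (2 * m + 3 : ℂ) * ∏ i : Fin (n + m + 1), ((kap n i : ℂ) - kap n (n + m + 1)) =
      -(((n : ℂ) + 2 * (m + 1) + 1) * (n + 2 * (m + 1))) *
        ∏ i : Fin (n + m), ((kap n i : ℂ) - kap n (n + m)) := by
  have h1 : ∏ i : Fin (n + m + 1), ((kap n i : ℂ) - kap n (n + m + 1)) = _ :=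
    prod_kap_sub n (m + 1)
  rw [h1, prod_kap_sub, prod_range_succ']
  have h2 : ∏ j ∈ range m, (2 * (((j + 1 : ℕ) : ℂ) - ((m + 1 : ℕ) : ℂ))) =
      ∏ j ∈ range m, (2 * ((j : ℂ) - m)) :=
    prod_congr rfl fun j _ => by push_cast; ring
  have h3 : ∀ n : ℕ, (2 * m + 3 : ℂ) * (2 * m + 2) *
      ∏ j ∈ range n, (-(2 * ((m + 1 : ℕ) : ℂ) + 2 + j)) =
      ((n : ℂ) + 2 * (m + 1) + 1) * (n + 2 * (m + 1)) * ∏ j ∈ range n, (-(2 * m + 2 + j : ℂ)) := by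
    intro n
    induction n with
    | zero => simp; ring
    | succ n ih =>
      rw [prod_range_succ, prod_range_succ, ← mul_assoc, ih]
      push_cast
      ring
  rw [h2]
  have := h3 n
  push_cast at this ⊢
  linear_combination (-∏ j ∈ range m, (2 * ((j : ℂ) - m))) * this

/-- This supplies the normalisation: passing from Wronskians to `U`, it cancels the scalar
prefactors of `bilinear_relation`. -/
theorem vandNeg_mul_vandNeg (n m : ℕ) :
    (2 * m + 3 : ℂ) * (vandNeg n (n + m) * vandNeg n (n + m + 2)) =
      -(((n : ℂ) + 2 * (m + 1) + 1) * (n + 2 * (m + 1))) * vandNeg n (n + m + 1) ^ 2 := by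
  rw [vandNeg_succ n (n + m + 1), vandNeg_succ n (n + m)]
  linear_combination vandNeg n (n + m) ^ 2 *
    (∏ i : Fin (n + m), ((kap n i : ℂ) - kap n (n + m))) * prod_kap_sub_succ n m

theorem prod_kap_succ_add_one (n m : ℕ) :
    2 * ∏ i : Fin (n + m), ((kap (n + 1) (i + 1) : ℂ) + 1) =
      ((n : ℂ) + 1) * (n + 2 + 2 * m) * ∏ i : Fin (n + m), ((kap (n + 1) (i + 1) : ℂ) - 1) := by
  rw [Fin.prod_univ_eq_prod_range (fun i => (kap (n + 1) (i + 1) : ℂ) + 1),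
    Fin.prod_univ_eq_prod_range (fun i => (kap (n + 1) (i + 1) : ℂ) - 1)]
  induction m with
  | zero =>
    have hk : ∀ i ∈ range n, kap (n + 1) (i + 1) = i + 2 := fun i hi => by
      rw [kap, if_pos (by have := mem_range.1 hi; omega)]
    have h1 : ∏ i ∈ range n, ((kap (n + 1) (i + 1) : ℂ) + 1) =
        ∏ i ∈ range n, (((i + 2 : ℕ) : ℂ) + 1) := prod_congr rfl fun i hi => by rw [hk i hi]
    have h2 : ∏ i ∈ range n, ((kap (n + 1) (i + 1) : ℂ) - 1) =
        ∏ i ∈ range n, (((i + 2 : ℕ) : ℂ) - 1) := prod_congr rfl fun i hi => by rw [hk i hi]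
    rw [add_zero, h1, h2]
    clear hk h1 h2
    induction n with
    | zero => simp
    | succ n ih =>
      rw [prod_range_succ, prod_range_succ, ← mul_assoc, ih]
      push_cast
      ring
  | succ m ih =>
    rw [← add_assoc, prod_range_succ, prod_range_succ, ← mul_assoc, ih]
    have : kap (n + 1) (n + m + 1) = n + 2 * m + 3 := by
      rw [show n + m + 1 = n + 1 + m by ring, kap_last]
      ring
    rw [this]
    push_cast
    ring

/-! ### The polynomials `U` as Wronskians -/

/-- The sign attached to an element of `I` in the definition of `U`. -/
def idxSign (n i : ℕ) : ℂ := if n < i then (-1) ^ ((i - n) / 2) else 1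

/-- The sign convention in `alph` is designed for this: with the Vandermonde sign of position `j` it
leaves `1` for indices up to `n` and the `(-1)^c` contribution beyond. -/
theorem neg_one_pow_mul_alph (n j : ℕ) (z a : ℂ) :
    (-1) ^ j * alph z a (kap n j) = idxSign n (kap n j) * (low a (kap n j) * z ^ kap n j) := by
  have key : (-1 : ℂ) ^ j * (-((-1) ^ kap n j)) = idxSign n (kap n j) := by
    rcases lt_or_ge j n with h | h
    · have h1 : ((-1 : ℂ) ^ j) * (-1) ^ j = 1 := by rw [← mul_pow]; simp
      rw [kap, if_pos h, idxSign, if_neg (by omega), pow_succ]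
      linear_combination h1
    · obtain ⟨t, rfl⟩ := Nat.exists_eq_add_of_le h
      have h1 : ((-1 : ℂ) ^ n) * (-1) ^ n = 1 := by rw [← mul_pow]; simp
      have h2 : n + 2 * (t + 1) - n = 2 * (t + 1) := by omega
      rw [kap_last, idxSign, if_pos (by omega), h2, Nat.mul_div_cancel_left _ two_pos, pow_add,
        pow_add _ n, pow_mul, pow_succ]
      simp only [even_two, Even.neg_pow, one_pow]
      linear_combination (-(-1 : ℂ) ^ t) * h1
  rw [alph, neg_pow z, ← key]
  ring

theorem cast_neg_one_pow_cExp (n : ℕ) (I : Finset ℕ) :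
    (((-1 : ℚ) ^ cExp n I : ℚ) : ℂ) = ∏ i ∈ I, idxSign n i := by
  rw [cExp, ← prod_pow_eq_pow_sum, prod_filter]
  push_cast
  refine prod_congr rfl fun i _ => ?_
  rw [idxSign]
  split_ifs <;> simp

/-- The enumeration of `[n;m]` as an embedding. -/
def kapEmb (n N s : ℕ) : Fin N ↪ ℕ :=
  ⟨fun i => kap n (i + s), fun _ _ h => Fin.ext (Nat.add_right_cancel
    ((kap_strictMono n).injective h))⟩

theorem kapEmb_apply (n N s : ℕ) (i : Fin N) : kapEmb n N s i = kap n (i + s) := rfl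

theorem idx_eq_map (n m : ℕ) : idx n m = univ.map (kapEmb n (n + m) 0) := by
  ext x
  simp only [idx, mem_union, mem_Icc, mem_image, mem_map, mem_univ, true_and, kapEmb_apply, add_zero]
  constructor
  · rintro (⟨h1, h2⟩ | ⟨j, ⟨h1, h2⟩, rfl⟩)
    · exact ⟨⟨x - 1, by omega⟩, by simp only [kap]; split_ifs <;> omega⟩
    · exact ⟨⟨n + j - 1, by omega⟩, by simp only [kap]; split_ifs <;> omega⟩
  · rintro ⟨i, rfl⟩
    have := i.2
    by_cases hi : (i : ℕ) < n
    · left; rw [kap, if_pos hi]; omega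
    · right; exact ⟨i + 1 - n, by omega, by rw [kap, if_neg hi]⟩

theorem idx_eq_insert (n m : ℕ) :
    idx (n + 1) m = insert 1 (univ.map (kapEmb (n + 1) (n + m) 1)) := by
  have h1 : kap (n + 1) 0 = 1 := by simp [kap]
  rw [idx_eq_map]
  ext x
  simp only [mem_insert, mem_map, mem_univ, true_and, kapEmb_apply]
  constructor
  · rintro ⟨i, rfl⟩
    obtain ⟨i, hi⟩ := i
    obtain _ | i := i
    · left; simpa using h1
    · right; exact ⟨⟨i, by omega⟩, by simp⟩
  · rintro (rfl | ⟨i, rfl⟩)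
    · exact ⟨⟨0, by omega⟩, by simpa using h1⟩
    · exact ⟨⟨i + 1, by omega⟩, by simp⟩

theorem one_notMem_map (n N : ℕ) (J : Finset (Fin N)) : 1 ∉ J.map (kapEmb n N 1) := by
  simp only [mem_map, kapEmb_apply, not_exists, not_and]
  intro i _ h
  have h1 := kap_strictMono n (Nat.succ_pos (i : ℕ))
  have h2 := kap_pos n 0
  rw [Nat.succ_eq_add_one, h] at h1
  omega

theorem sum_powerset_map {N : ℕ} (e : Fin N ↪ ℕ) (f : Finset ℕ → ℂ) :
    ∑ I ∈ (univ.map e).powerset, f I = ∑ J : Finset (Fin N), f (J.map e) := by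
  symm
  refine sum_nbij (fun J => J.map e) ?_ ?_ ?_ ?_
  · intro J _
    simp [map_subset_map]
  · intro J _ J' _ h
    exact map_injective e h
  · intro I hI
    obtain ⟨J, -, rfl⟩ := subset_map_iff.1 (mem_powerset.1 hI)
    exact ⟨J, by simp, rfl⟩
  · intro J _; rfl

theorem map_univ_sdiff {N : ℕ} (e : Fin N ↪ ℕ) (J : Finset (Fin N)) :
    univ.map e \ J.map e = Jᶜ.map e := by
  rw [← Finset.map_sdiff, compl_eq_univ_sdiff]

/-- The moments of `U` with respect to the degree in `z` minus the degree in `w`. -/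
def Umom (n m r : ℕ) (z w a b : ℂ) : ℂ :=
  ∑ I ∈ (idx n m).powerset, ((dCoeff n m I * (-1) ^ cExp n I : ℚ) : ℂ) * eTerm n m 0 I z w a b *
    ((∑ i ∈ I, (i : ℂ)) - ∑ i ∈ idx n m \ I, (i : ℂ)) ^ r

theorem Umom_zero (n m : ℕ) (z w a b : ℂ) : Umom n m 0 z w a b = U n m 0 z w a b := by
  simp [Umom, U]

theorem tauU_eq (n m r : ℕ) (z w a b : ℂ) :
    tauU n (n + m) r z w a b = vandNeg n (n + m) * Umom n m r z w a b := by
  have hidx := idx_eq_map n m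
  set e := kapEmb n (n + m) 0 with he
  have hev : ∀ i, e i = kap n i := fun i => rfl
  rw [Umom, hidx, sum_powerset_map, tauU, tau, mul_sum]
  refine sum_congr rfl fun J _ => ?_
  change _ * (vand (sgnVec J fun i => (kap n i : ℂ)) *
    (∑ i, sgnVec J (fun i => (kap n i : ℂ)) i) ^ r) = _
  rw [vand_sgnVec (ν := fun i : Fin (n + m) => kap n i) (fun i j h => kap_strictMono n h), sum_sgnVec, dCoeff, eTerm, hidx,
    map_univ_sdiff, ← vandNeg]
  push_cast [← cast_neg_one_pow_cExp]
  have hc := cast_neg_one_pow_cExp n (J.map e)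
  push_cast at hc
  rw [hc]
  simp only [Icc_eq_empty_of_lt Nat.zero_lt_one, sdiff_empty, prod_map, sum_map, hev,
    ← prod_pow_eq_pow_sum]
  have hα : (∏ i ∈ J, alph z a (kap n i)) * ∏ j ∈ J, (-1 : ℂ) ^ (j : ℕ) =
      (∏ i ∈ J, idxSign n (kap n i)) * ((∏ i ∈ J, low a (kap n i)) * ∏ i ∈ J, z ^ kap n i) := by
    simp only [← prod_mul_distrib]
    refine prod_congr rfl fun i _ => ?_
    rw [mul_comm, neg_one_pow_mul_alph]
  have hβ : ∏ i ∈ Jᶜ, bet w b (kap n i) =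
      (∏ i ∈ Jᶜ, low b (kap n i)) * ∏ i ∈ Jᶜ, w ^ kap n i := by
    simp only [← prod_mul_distrib, bet]
  have habs : ∏ i ∈ J, ∏ j ∈ Jᶜ, ((absRatio (kap n i) (kap n j) : ℚ) : ℂ) =
    ∏ i ∈ J, ∏ j ∈ Jᶜ, ((|((kap n i : ℚ) + kap n j) / ((kap n i : ℚ) - kap n j)| : ℚ) : ℂ) := rfl
  rw [habs, hβ]
  linear_combination (∏ i ∈ Jᶜ, low b (kap n i)) * (∏ i ∈ Jᶜ, w ^ kap n i) * vandNeg n (n + m) *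
    (∏ i ∈ J, ∏ j ∈ Jᶜ, ((|((kap n i : ℚ) + kap n j) / ((kap n i : ℚ) - kap n j)| : ℚ) : ℂ)) *
    (∑ i ∈ J, (kap n i : ℂ) - ∑ i ∈ Jᶜ, (kap n i : ℂ)) ^ r * hα

theorem U_zero_one (m : ℕ) (z w a b : ℂ) : U 0 m 1 z w a b = 0 := by
  refine sum_eq_zero fun I hI => ?_
  exfalso
  rw [mem_filter, mem_powerset] at hI
  have h := hI.1 (hI.2 (by simp : 1 ∈ Icc 1 1))
  simp [idx] at h

/-- The Vandermonde product of the negated indices other than the first. -/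
def vandNegTail (n N : ℕ) : ℂ := vand fun i : Fin N => -(kap n (i + 1) : ℂ)

/-- With `1 ∈ I`, the elements outside `I` contribute `(j + 1)/(j - 1)` through `d(I)`, and those of
`I` other than 1 contribute `(i + 1)/(1 - i)` through the prefactor. Together they form a product
independent of `I`, up to one sign per element, absorbed by the shift of positions after removing
the index 1. -/
theorem U_one_eq (n m : ℕ) (z w a b : ℂ) :
    (∏ i : Fin (n + m), (((kap (n + 1) (i + 1) : ℂ) + 1) / (kap (n + 1) (i + 1) - 1))) *
      wr (fun i : Fin (n + m) => phi z w a b (kap (n + 1) (i + 1))) =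
      vandNegTail (n + 1) (n + m) * U (n + 1) m 1 z w a b := by
  have hidx := idx_eq_insert n m
  set e := kapEmb (n + 1) (n + m) 1 with he
  have hev : ∀ i, e i = kap (n + 1) (i + 1) := fun i => rfl
  have hgt : ∀ i : Fin (n + m), 1 < kap (n + 1) (i + 1) := fun i =>
    lt_of_le_of_lt (kap_pos (n + 1) 0) (kap_strictMono (n + 1) (Nat.succ_pos i))
  rw [U, hidx, sum_filter, sum_powerset_insert (one_notMem_map _ _ _), sum_powerset_map,
    sum_powerset_map, sum_eq_zero, zero_add]
  swap
  · intro J _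
    rw [if_neg]
    intro h
    exact one_notMem_map _ _ J (h (by simp))
  change _ * wr (fun i : Fin (n + m) => solRow (kap (n + 1) (i + 1) : ℂ)
    (alph z a (kap (n + 1) (i + 1))) (bet w b (kap (n + 1) (i + 1)))) = _
  rw [wr_solRow, tau, mul_sum, mul_sum]
  refine sum_congr rfl fun J _ => ?_
  have hI : insert 1 (J.map e) \ Icc 1 1 = J.map e := by
    rw [Icc_self, insert_sdiff_of_mem _ (mem_singleton_self 1), sdiff_singleton_eq_erase,
      erase_eq_of_notMem (one_notMem_map _ _ J)]
  have hI' : insert 1 (univ.map e) \ insert 1 (J.map e) = Jᶜ.map e := by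
    rw [insert_sdiff_insert, sdiff_insert, map_univ_sdiff,
      erase_eq_of_notMem (one_notMem_map _ _ _)]
  have hc := cast_neg_one_pow_cExp (n + 1) (insert 1 (J.map e))
  rw [prod_insert (one_notMem_map _ _ J), idxSign, if_neg (by omega), one_mul] at hc
  rw [if_pos (by simp), vand_sgnVec (ν := fun i : Fin (n + m) => kap (n + 1) (i + 1))
    (fun i j h => kap_strictMono (n + 1) (Nat.succ_lt_succ h)), dCoeff, eTerm, hidx, hI, hI',
    prod_insert (one_notMem_map _ _ J), ← vandNegTail, pow_zero, mul_one]
  push_cast at hc ⊢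
  rw [hc]
  simp only [Icc_self, prod_singleton, prod_map, sum_map, hev, kapEmb_apply, Nat.cast_one,
    ← prod_pow_eq_pow_sum]
  have hα : (∏ i ∈ J, alph z a (kap (n + 1) (i + 1))) * ∏ j ∈ J, (-1 : ℂ) ^ (j : ℕ) =
      (∏ i ∈ J, (-1 : ℂ)) * (∏ i ∈ J, idxSign (n + 1) (kap (n + 1) (i + 1))) *
        ((∏ i ∈ J, low a (kap (n + 1) (i + 1))) * ∏ i ∈ J, z ^ kap (n + 1) (i + 1)) := by
    simp only [← prod_mul_distrib]
    refine prod_congr rfl fun i _ => ?_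
    rw [mul_assoc, ← neg_one_pow_mul_alph, pow_succ]
    ring
  have hβ : ∏ i ∈ Jᶜ, bet w b (kap (n + 1) (i + 1)) =
      (∏ i ∈ Jᶜ, low b (kap (n + 1) (i + 1))) * ∏ i ∈ Jᶜ, w ^ kap (n + 1) (i + 1) := by
    simp only [← prod_mul_distrib, bet]
  have habs : ∏ i ∈ J, ∏ j ∈ Jᶜ,
      ((absRatio (kap (n + 1) (i + 1)) (kap (n + 1) (j + 1)) : ℚ) : ℂ) =
    ∏ i ∈ J, ∏ j ∈ Jᶜ, ((|((kap (n + 1) (i + 1) : ℚ) + kap (n + 1) (j + 1)) /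
      ((kap (n + 1) (i + 1) : ℚ) - kap (n + 1) (j + 1))| : ℚ) : ℂ) := rfl
  have h1 : ∏ j ∈ Jᶜ, ((|(1 + (kap (n + 1) (j + 1) : ℚ)) / (1 - (kap (n + 1) (j + 1) : ℚ))| : ℚ) : ℂ)
      = ∏ j ∈ Jᶜ, (((kap (n + 1) (j + 1) : ℂ) + 1) / (kap (n + 1) (j + 1) - 1)) := by
    refine prod_congr rfl fun j _ => ?_
    have := absRatio_of_lt (hgt j)
    rw [absRatio, Nat.cast_one] at this
    rw [this, add_comm]
    push_cast
    rfl
  have h2 : ∏ i ∈ J, (((kap (n + 1) (i + 1) : ℂ) + 1) / (1 - kap (n + 1) (i + 1))) =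
      (∏ i ∈ J, (-1 : ℂ)) *
        ∏ i ∈ J, (((kap (n + 1) (i + 1) : ℂ) + 1) / (kap (n + 1) (i + 1) - 1)) := by
    rw [← prod_mul_distrib]
    refine prod_congr rfl fun i _ => ?_
    rw [← neg_sub, div_neg]
    ring
  rw [habs, hβ, h1, h2, ← prod_mul_prod_compl J]
  linear_combination
    (∏ i ∈ J, (((kap (n + 1) (i + 1) : ℂ) + 1) / (kap (n + 1) (i + 1) - 1))) *
    (∏ i ∈ Jᶜ, (((kap (n + 1) (i + 1) : ℂ) + 1) / (kap (n + 1) (i + 1) - 1))) *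
    ((∏ i ∈ Jᶜ, low b (kap (n + 1) (i + 1))) * ∏ i ∈ Jᶜ, w ^ kap (n + 1) (i + 1)) *
    vandNegTail (n + 1) (n + m) *
    (∏ i ∈ J, ∏ j ∈ Jᶜ, ((|((kap (n + 1) (i + 1) : ℚ) + kap (n + 1) (j + 1)) /
      ((kap (n + 1) (i + 1) : ℚ) - kap (n + 1) (j + 1))| : ℚ) : ℂ)) * hα

/-! ### The algebraic form of the recurrence -/

/-- The degree of `U n m 0` in `(z, w)`. -/
def degU (n m : ℕ) : ℕ := ∑ i ∈ idx n m, i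

theorem sum_kap_eq_degU (n m : ℕ) : ∑ i : Fin (n + m), (kap n i : ℂ) = degU n m := by
  rw [degU, idx_eq_map, sum_map]
  push_cast
  rfl

theorem vandNeg_eq_vandNegTail (n N : ℕ) :
    vandNeg (n + 1) (N + 1) =
      (∏ i : Fin N, (1 - (kap (n + 1) (i + 1) : ℂ))) * vandNegTail (n + 1) N := by
  have h1 : kap (n + 1) 0 = 1 := by simp [kap]
  rw [vandNeg, fun_eq_cons (fun i => -(kap (n + 1) i : ℂ)), vand_cons, vandNegTail, h1]
  congr 1
  exact prod_congr rfl fun i _ => by push_cast; ring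

/-- The product of `(k + 1)/(k - 1)` over the indices other than 1 telescopes to `n(n + 2(m + 1) +
1)/2`; this is the source of the constant `4/(n + 2m + 1)²` in the recurrence. -/
theorem lowered_term_eq (n m : ℕ) (z w a b : ℂ) :
    ((n : ℂ) + 2 * (m + 1) + 1) * (n * ((∏ i : Fin (n + m), ((kap n (i + 1) : ℂ) ^ 2 - 1)) *
      wr (fun i : Fin (n + m) => phi z w a b (kap n (i + 1))) ^ 2)) =
      2 * vandNeg n (n + m + 1) ^ 2 * U n (m + 1) 1 z w a b ^ 2 := by
  obtain _ | n := n
  · simp [U_zero_one]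
  have hU : (∏ i : Fin (n + 1 + m),
      (((kap (n + 1) (i + 1) : ℂ) + 1) / (kap (n + 1) (i + 1) - 1))) *
      wr (fun i : Fin (n + 1 + m) => phi z w a b (kap (n + 1) (i + 1))) =
      vandNegTail (n + 1) (n + 1 + m) * U (n + 1) (m + 1) 1 z w a b := by
    have := U_one_eq n (m + 1) z w a b
    rw [show n + (m + 1) = n + 1 + m by ring] at this
    exact this
  have hP : 2 * ∏ i : Fin (n + 1 + m), ((kap (n + 1) (i + 1) : ℂ) + 1) =
      ((n : ℂ) + 1) * (n + 2 + 2 * (m + 1)) *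
        ∏ i : Fin (n + 1 + m), ((kap (n + 1) (i + 1) : ℂ) - 1) := by
    have := prod_kap_succ_add_one n (m + 1)
    rw [show n + (m + 1) = n + 1 + m by ring] at this
    push_cast at this
    exact this
  have hne : ∏ i : Fin (n + 1 + m), ((kap (n + 1) (i + 1) : ℂ) - 1) ≠ 0 := by
    refine prod_ne_zero_iff.2 fun i _ => sub_ne_zero.2 ?_
    have : 1 < kap (n + 1) (i + 1) :=
      lt_of_le_of_lt (kap_pos (n + 1) 0) (kap_strictMono (n + 1) (Nat.succ_pos i))
    exact_mod_cast this.ne'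
  have hsq : ∏ i : Fin (n + 1 + m), ((kap (n + 1) (i + 1) : ℂ) ^ 2 - 1) =
      (∏ i : Fin (n + 1 + m), ((kap (n + 1) (i + 1) : ℂ) + 1)) *
        ∏ i : Fin (n + 1 + m), ((kap (n + 1) (i + 1) : ℂ) - 1) := by
    rw [← prod_mul_distrib]
    exact prod_congr rfl fun i _ => by ring
  have hv : vandNeg (n + 1) (n + 1 + m + 1) ^ 2 =
      (∏ i : Fin (n + 1 + m), ((kap (n + 1) (i + 1) : ℂ) - 1)) ^ 2 *
        vandNegTail (n + 1) (n + 1 + m) ^ 2 := by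
    rw [vandNeg_eq_vandNegTail, mul_pow, ← prod_pow, ← prod_pow]
    congr 1
    exact prod_congr rfl fun i _ => by ring
  rw [prod_div_distrib] at hU
  rw [hsq, hv]
  set A := ∏ i : Fin (n + 1 + m), ((kap (n + 1) (i + 1) : ℂ) + 1)
  set B := ∏ i : Fin (n + 1 + m), ((kap (n + 1) (i + 1) : ℂ) - 1)
  set W := wr (fun i : Fin (n + 1 + m) => phi z w a b (kap (n + 1) (i + 1)))
  have hU' : A * W = B * (vandNegTail (n + 1) (n + 1 + m) * U (n + 1) (m + 1) 1 z w a b) := by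
    rw [← hU]
    field_simp
  push_cast
  linear_combination (-(A * W ^ 2)) * hP + 2 * (A * W +
    B * (vandNegTail (n + 1) (n + 1 + m) * U (n + 1) (m + 1) 1 z w a b)) * hU'

/-- The algebraic form of the Toda recurrence. -/
theorem toda_algebraic (n m : ℕ) {z w : ℂ} (hzw : w ^ 2 - z ^ 2 = 1) (a b : ℂ) :
    U n m 0 z w a b * U n (m + 2) 0 z w a b =
      (-bar a (n + 2 * (m + 1) + 2) * z ^ 2 + bar b (n + 2 * (m + 1) + 2) * w ^ 2) *
          U n (m + 1) 0 z w a b ^ 2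
        + (U n (m + 1) 0 z w a b * Umom n (m + 1) 2 z w a b - Umom n (m + 1) 1 z w a b ^ 2
          - 2 * (z ^ 2 + w ^ 2) * (U n (m + 1) 0 z w a b * Umom n (m + 1) 1 z w a b)
          - 2 * degU n (m + 1) * U n (m + 1) 0 z w a b ^ 2)
        - 4 / ((n : ℂ) + 2 * (m + 1) + 1) ^ 2 * (a * b * (a - b)) * z ^ 2 * w ^ 2 *
          U n (m + 1) 1 z w a b ^ 2 := by
  have hbil := bilinear_relation n m z w a b
  have hlow := lowered_term_eq n m z w a b
  have hvv := vandNeg_mul_vandNeg n m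
  have hd : ∑ i : Fin (n + m + 1), (kap n i : ℂ) = degU n (m + 1) := sum_kap_eq_degU n (m + 1)
  have t0 := tauU_eq n m 0 z w a b
  have t2 : tauU n (n + m + 2) 0 z w a b = _ := tauU_eq n (m + 2) 0 z w a b
  have t1 : ∀ r, tauU n (n + m + 1) r z w a b = vandNeg n (n + m + 1) * Umom n (m + 1) r z w a b :=
    fun r => tauU_eq n (m + 1) r z w a b
  rw [t0, t2, t1, t1, t1, hd] at hbil
  simp only [Umom_zero, ← add_assoc] at hbil
  have hv := vandNeg_ne_zero n (n + m + 1)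
  have hr : (n : ℂ) + 2 * (m + 1) + 1 ≠ 0 := by
    exact_mod_cast (by omega : n + 2 * (m + 1) + 1 ≠ 0)
  have hp : (n : ℂ) + 2 * (m + 1) ≠ 0 := by
    exact_mod_cast (by omega : n + 2 * (m + 1) ≠ 0)
  have hK := div_mul_cancel₀ (4 : ℂ) (pow_ne_zero 2 hr)
  simp only [bar]
  push_cast
  generalize 4 / ((n : ℂ) + 2 * (m + 1) + 1) ^ 2 = K at hK ⊢
  -- After clearing denominators and the Vandermonde constant, the claim is linear in the relations
  -- already proved; everything else is made atomic.
  refine mul_left_cancel₀ (mul_ne_zero (mul_ne_zero (pow_ne_zero 2 hr) hp) (pow_ne_zero 2 hv)) ?_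
  generalize vandNeg n (n + m + 1) = v at *
  generalize vandNeg n (n + m) = V₀ at *
  generalize vandNeg n (n + m + 2) = V₂ at *
  generalize ∏ i : Fin (n + m), ((kap n (i + 1) : ℂ) ^ 2 - 1) = P at *
  generalize wr (fun i : Fin (n + m) => phi z w a b (kap n (i + 1))) = W at *
  generalize U n (m + 1) 1 z w a b = U₁ at *
  generalize U n (m + 1) 0 z w a b = u₀ at *
  generalize Umom n (m + 1) 1 z w a b = u₁ at *
  generalize Umom n (m + 1) 2 z w a b = u₂ at *
  generalize U n m 0 z w a b = Um at *
  generalize U n (m + 2) 0 z w a b = Up at *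
  linear_combination ((n : ℂ) + 2 * (m + 1) + 1) * Um * Up * hvv
    - ((n : ℂ) + 2 * (m + 1) + 1) * hbil
    - 2 * ((n : ℂ) + 2 * (m + 1)) * (a * b * (a - b)) * z ^ 2 * w ^ 2 * hlow
    + ((n : ℂ) + 2 * (m + 1) + 1) ^ 2 * (n + 2 * (m + 1)) * v ^ 2 *
      (u₀ * u₂ - u₁ ^ 2 - 2 * degU n (m + 1) * u₀ ^ 2) * hzw
    + ((n : ℂ) + 2 * (m + 1)) * v ^ 2 * (a * b * (a - b)) * z ^ 2 * w ^ 2 * U₁ ^ 2 * hK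

/-! ### The recurrence along curves -/

theorem sum_add_sum_idx_sdiff {n m : ℕ} {I : Finset ℕ} (hI : I ∈ (idx n m).powerset) :
    ∑ i ∈ I, i + ∑ i ∈ idx n m \ I, i = degU n m := by
  rw [degU, add_comm, sum_sdiff (mem_powerset.1 hI)]

theorem hasDerivAt_monomial {𝕜 : Type*} [NontriviallyNormedField 𝕜] [NormedAlgebra 𝕜 ℂ]
    {z w : 𝕜 → ℂ} {h : ℂ} {t : 𝕜} (hz0 : z t ≠ 0) (hw0 : w t ≠ 0)
    (hz : HasDerivAt z (h / z t) t) (hw : HasDerivAt w (h / w t) t) (c : ℂ) (p q : ℕ) :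
    HasDerivAt (fun t => c * z t ^ p * w t ^ q)
      (c * z t ^ p * w t ^ q * (p * (h / z t ^ 2) + q * (h / w t ^ 2))) t := by
  have key : ∀ (x : ℂ) (k : ℕ), x ≠ 0 → (k : ℂ) * x ^ (k - 1) * (h / x) =
      k * x ^ k * (h / x ^ 2) := by
    intro x k hx
    obtain _ | k := k
    · simp
    · rw [Nat.add_sub_cancel, pow_succ x k]
      field_simp
  have h1 := ((hz.fun_pow p).const_mul c).mul (hw.fun_pow q)
  refine h1.congr_deriv ?_
  rw [key _ _ hz0, key _ _ hw0]
  ring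

/-- For `z^p w^q` the logarithmic derivative is `(p w² + q z²)/(4h)`. Writing `p` and `q` through `p
+ q`, the constant degree, and `p - q`, the eigenvalue of `D`, the latter gets the coefficient `w² -
z² = 1`. -/
theorem hasDerivAt_Umom {𝕜 : Type*} [NontriviallyNormedField 𝕜] [NormedAlgebra 𝕜 ℂ]
    {z w : 𝕜 → ℂ} {h : ℂ} {t : 𝕜} (hz0 : z t ≠ 0) (hw0 : w t ≠ 0)
    (hz : HasDerivAt z (h / z t) t) (hw : HasDerivAt w (h / w t) t)
    (hsub : w t ^ 2 - z t ^ 2 = 1) (hh : 4 * h ^ 2 = z t ^ 2 * w t ^ 2)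
    (n m r : ℕ) (a b : ℂ) :
    HasDerivAt (fun t => Umom n m r (z t) (w t) a b)
      (((z t ^ 2 + w t ^ 2) * degU n m * Umom n m r (z t) (w t) a b +
        Umom n m (r + 1) (z t) (w t) a b) / (8 * h)) t := by
  have hh0 : h ≠ 0 := by
    rintro rfl
    have : z t ^ 2 * w t ^ 2 ≠ 0 := mul_ne_zero (pow_ne_zero 2 hz0) (pow_ne_zero 2 hw0)
    exact this (by rw [← hh]; ring)
  have h1 : h / z t ^ 2 = w t ^ 2 / (4 * h) := by
    field_simp
    linear_combination hh
  have h2 : h / w t ^ 2 = z t ^ 2 / (4 * h) := by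
    field_simp
    linear_combination hh
  simp only [Umom]
  rw [mul_sum, ← sum_add_distrib, sum_div]
  refine HasDerivAt.fun_sum fun I hI => ?_
  have hd : ((∑ i ∈ I, (i : ℂ)) + ∑ i ∈ idx n m \ I, (i : ℂ)) = degU n m := by
    rw [← sum_add_sum_idx_sdiff hI]
    push_cast
    rfl
  have h3 := (hasDerivAt_monomial hz0 hw0 hz hw (((dCoeff n m I * (-1) ^ cExp n I : ℚ) : ℂ) *
    ((∏ i ∈ I, low a i) * (∏ i ∈ idx n m \ I, low b i))) (∑ i ∈ I, i)
    (∑ i ∈ idx n m \ I, i)).mul_const (((∑ i ∈ I, (i : ℂ)) - ∑ i ∈ idx n m \ I, (i : ℂ)) ^ r)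
  simp only [eTerm, Icc_eq_empty_of_lt Nat.zero_lt_one, sdiff_empty]
  refine (h3.congr_deriv ?_).congr_of_eventuallyEq (Filter.Eventually.of_forall fun t => ?_)
  · rw [h1, h2, ← hd]
    push_cast
    field_simp
    linear_combination (4 * (((dCoeff n m I : ℚ) : ℂ) * (∏ i ∈ I, low a i) *
      (∏ i ∈ idx n m \ I, low b i) *
      ((∑ i ∈ I, (i : ℂ)) - ∑ i ∈ idx n m \ I, (i : ℂ)) ^ (r + 1))) * hsub
  · ring

theorem todaRecurrence_of_hasDerivAt {𝕜 : Type*} [NontriviallyNormedField 𝕜] [NormedAlgebra 𝕜 ℂ]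
    {z w h : 𝕜 → ℂ} {x : 𝕜}
    (hev : ∀ᶠ t in nhds x, z t ≠ 0 ∧ w t ≠ 0 ∧ HasDerivAt z (h t / z t) t ∧
      HasDerivAt w (h t / w t) t ∧ w t ^ 2 - z t ^ 2 = 1 ∧ 4 * h t ^ 2 = z t ^ 2 * w t ^ 2)
    (hh : HasDerivAt h ((z x ^ 2 + w x ^ 2) / 4) x) (n : ℕ) {m : ℕ} (hm : 1 ≤ m) (a b : ℂ) :
    TodaRecurrence n m a b z w x := by
  obtain ⟨m, rfl⟩ := Nat.exists_eq_add_of_le' hm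
  obtain ⟨hz0, hw0, hz, hw, hsub, hsq⟩ := hev.self_of_nhds
  have hh0 : h x ≠ 0 := by
    intro h0
    have : z x ^ 2 * w x ^ 2 ≠ 0 := mul_ne_zero (pow_ne_zero 2 hz0) (pow_ne_zero 2 hw0)
    exact this (by rw [← hsq, h0]; ring)
  set f : ℕ → 𝕜 → ℂ := fun r t => Umom n (m + 1) r (z t) (w t) a b with hf
  have hder : ∀ᶠ t in nhds x, ∀ r, HasDerivAt (f r)
      (((z t ^ 2 + w t ^ 2) * degU n (m + 1) * f r t + f (r + 1) t) / (8 * h t)) t := by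
    filter_upwards [hev] with t ht r
    exact hasDerivAt_Umom ht.1 ht.2.1 ht.2.2.1 ht.2.2.2.1 ht.2.2.2.2.1 ht.2.2.2.2.2 _ _ _ _ _
  have hd1 : deriv (f 0) =ᶠ[nhds x] fun t =>
      ((z t ^ 2 + w t ^ 2) * degU n (m + 1) * f 0 t + f 1 t) / (8 * h t) := by
    filter_upwards [hder] with t ht
    exact (ht 0).deriv
  have hder' := hder.self_of_nhds
  have hσ : HasDerivAt (fun t => z t ^ 2 + w t ^ 2) (4 * h x) x := by
    refine ((hz.fun_pow 2).add (hw.fun_pow 2)).congr_deriv ?_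
    field_simp
    push_cast
    ring
  have hd2 := ((((hσ.mul_const (degU n (m + 1) : ℂ)).mul (hder' 0)).add (hder' 1)).div
    (hh.const_mul 8) (mul_ne_zero (by norm_num) hh0)).deriv
  have hd2' : deriv (deriv (f 0)) x = _ := hd1.deriv_eq.trans hd2
  have hd1' := hd1.self_of_nhds
  have hU : (fun t => U n (m + 1) 0 (z t) (w t) a b) = f 0 := by
    ext t; rw [hf]; exact (Umom_zero _ _ _ _ _ _).symm
  have halg := toda_algebraic n m hsub a b
  rw [TodaRecurrence, hirotaD2, hU, hd2', hd1', Nat.add_sub_cancel, halg]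
  have e0 : U n (m + 1) 0 (z x) (w x) a b = f 0 x := congrFun hU x
  have e1 : Umom n (m + 1) 1 (z x) (w x) a b = f 1 x := rfl
  have e2 : Umom n (m + 1) 2 (z x) (w x) a b = f 2 x := rfl
  rw [e0, e1, e2]
  have hA : (z x ^ 2 + w x ^ 2) ^ 2 = 1 + 16 * h x ^ 2 := by
    linear_combination (w x ^ 2 - z x ^ 2 + 1) * hsub - 4 * hsq
  have hzw : 8 * z x ^ 2 * w x ^ 2 = 32 * h x ^ 2 := by linear_combination -8 * hsq
  rw [hzw]
  simp only [Pi.add_apply, Pi.mul_apply]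
  generalize f 0 x = f₀
  generalize f 1 x = f₁
  generalize f 2 x = f₂
  generalize z x ^ 2 + w x ^ 2 = A at *
  generalize (degU n (m + 1) : ℂ) = d
  generalize h x = y at *
  push_cast
  have key : f₀ * f₂ - f₁ ^ 2 - 2 * A * (f₀ * f₁) - 2 * d * f₀ ^ 2 =
      32 * y ^ 2 * (((4 * y * d * f₀ + A * d * ((A * d * f₀ + f₁) / (8 * y)) +
        (A * d * f₁ + f₂) / (8 * y)) * (8 * y) - (A * d * f₀ + f₁) * (8 * (A / 4))) /
        (8 * y) ^ 2 * f₀ - 2 * ((A * d * f₀ + f₁) / (8 * y) * ((A * d * f₀ + f₁) / (8 * y))) +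
        f₀ * (((4 * y * d * f₀ + A * d * ((A * d * f₀ + f₁) / (8 * y)) +
        (A * d * f₁ + f₂) / (8 * y)) * (8 * y) - (A * d * f₀ + f₁) * (8 * (A / 4))) /
        (8 * y) ^ 2)) := by
    field_simp
    linear_combination 512 * d * f₀ ^ 2 * hA
  linear_combination key

/-! ### Real curves, zeros of `zw`, and holomorphic branches -/

theorem todaRecurrence_real (n : ℕ) {m : ℕ} (hm : 1 ≤ m) (a b : ℂ) {x : ℝ} (hx : x ≠ 0) :
    TodaRecurrence n m a b
      (fun t : ℝ => ((1 / 2 * √(Real.exp t + Real.exp (-t) - 2) : ℝ) : ℂ))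
      (fun t : ℝ => ((1 / 2 * √(Real.exp t + Real.exp (-t) + 2) : ℝ) : ℂ)) x := by
  have hpos : ∀ t : ℝ, t ≠ 0 → 0 < Real.exp t + Real.exp (-t) - 2 := by
    intro t ht
    have := Real.one_lt_cosh.2 ht
    rw [Real.cosh_eq] at this
    linarith
  have hpos' : ∀ t : ℝ, 0 < Real.exp t + Real.exp (-t) + 2 := fun t => by positivity
  have hprod : ∀ t : ℝ, Real.exp t * Real.exp (-t) = 1 := fun t => by
    rw [← Real.exp_add]; simp
  have hsum : ∀ t : ℝ, HasDerivAt (fun t => Real.exp t + Real.exp (-t))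
      (Real.exp t - Real.exp (-t)) t := fun t => by
    refine ((Real.hasDerivAt_exp t).add (hasDerivAt_neg t).exp).congr_deriv ?_
    ring
  refine todaRecurrence_of_hasDerivAt
    (h := fun t : ℝ => (((Real.exp t - Real.exp (-t)) / 8 : ℝ) : ℂ)) ?_ ?_ n hm a b
  · filter_upwards [isOpen_ne.mem_nhds hx] with t ht
    have h1 := Real.sqrt_pos.2 (hpos t ht)
    have h2 := Real.sqrt_pos.2 (hpos' t)
    have h3 := Real.sq_sqrt (hpos t ht).le
    have h4 := Real.sq_sqrt (hpos' t).le
    refine ⟨?_, ?_, ?_, ?_, ?_, ?_⟩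
    · exact Complex.ofReal_ne_zero.2 (by positivity)
    · exact Complex.ofReal_ne_zero.2 (by positivity)
    · rw [← Complex.ofReal_div]
      refine HasDerivAt.ofReal_comp ?_
      refine ((((hsum t).sub_const 2).sqrt (hpos t ht).ne').const_mul (1 / 2)).congr_deriv ?_
      field_simp
      ring
    · rw [← Complex.ofReal_div]
      refine HasDerivAt.ofReal_comp ?_
      refine ((((hsum t).add_const 2).sqrt (hpos' t).ne').const_mul (1 / 2)).congr_deriv ?_
      field_simp
      ring
    · rw [← Complex.ofReal_pow, ← Complex.ofReal_pow, ← Complex.ofReal_sub, mul_pow, mul_pow, h3,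
        h4]
      norm_num
      ring
    · have h5 := hprod t
      rw [← Complex.ofReal_pow, ← Complex.ofReal_pow, ← Complex.ofReal_pow, ← Complex.ofReal_mul,
        mul_pow, mul_pow, h3, h4, ← Complex.ofReal_ofNat, ← Complex.ofReal_mul]
      congr 1
      linear_combination (-1 / 4 : ℝ) * h5
  · have h3 := Real.sq_sqrt (hpos x hx).le
    have h4 := Real.sq_sqrt (hpos' x).le
    have h5 : HasDerivAt (fun t : ℝ => (Real.exp t - Real.exp (-t)) / 8)
        ((Real.exp x + Real.exp (-x)) / 8) x := by
      refine (((Real.hasDerivAt_exp x).sub (hasDerivAt_neg x).exp).div_const 8).congr_deriv ?_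
      ring
    refine h5.ofReal_comp.congr_deriv ?_
    rw [← Complex.ofReal_pow, ← Complex.ofReal_pow, ← Complex.ofReal_add, mul_pow, mul_pow, h3,
        h4, ← Complex.ofReal_ofNat, ← Complex.ofReal_div]
    congr 1
    ring

/-- Only `I = ∅` survives, so `U` is an eigenvector of `D`. Points with `zw = 0` need separate
treatment because holomorphic branches such as `sinh (x/2)` pass through zero, where `h / z` is
meaningless. -/
theorem Umom_of_z_eq_zero (n m r : ℕ) (w a b : ℂ) :
    Umom n m r 0 w a b = (-degU n m) ^ r * Umom n m 0 0 w a b := by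
  rw [Umom, Umom, mul_sum]
  refine sum_congr rfl fun I hI => ?_
  by_cases h : ∑ i ∈ I, i = 0
  · have hd := sum_add_sum_idx_sdiff hI
    have h1 : ∑ i ∈ I, (i : ℂ) = 0 := by rw [← Nat.cast_sum, h, Nat.cast_zero]
    have h2 : ∑ i ∈ idx n m \ I, (i : ℂ) = degU n m := by
      rw [h, zero_add] at hd
      rw [← hd, Nat.cast_sum]
    rw [h1, h2, zero_sub, pow_zero]
    ring
  · have : eTerm n m 0 I 0 w a b = 0 := by
      simp [eTerm, zero_pow h]
    rw [this]
    ring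

theorem Umom_of_w_eq_zero (n m r : ℕ) (z a b : ℂ) :
    Umom n m r z 0 a b = degU n m ^ r * Umom n m 0 z 0 a b := by
  rw [Umom, Umom, mul_sum]
  refine sum_congr rfl fun I hI => ?_
  by_cases h : ∑ i ∈ idx n m \ I, i = 0
  · have hd := sum_add_sum_idx_sdiff hI
    have h1 : ∑ i ∈ idx n m \ I, (i : ℂ) = 0 := by
      rw [← Nat.cast_sum, h, Nat.cast_zero]
    have h2 : ∑ i ∈ I, (i : ℂ) = degU n m := by
      rw [h, add_zero] at hd
      rw [← hd, Nat.cast_sum]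
    rw [h1, h2, sub_zero, pow_zero]
    ring
  · have : eTerm n m 0 I z 0 a b = 0 := by
      simp [eTerm, zero_pow h]
    rw [this]
    ring

/-- If `z w = 0` the recurrence involves no derivatives. -/
theorem todaRecurrence_of_mul_eq_zero {𝕜 : Type*} [NontriviallyNormedField 𝕜] [NormedSpace 𝕜 ℂ]
    {z w : 𝕜 → ℂ} {x : 𝕜} (h0 : z x * w x = 0) (hsub : w x ^ 2 - z x ^ 2 = 1)
    (n : ℕ) {m : ℕ} (hm : 1 ≤ m) (a b : ℂ) : TodaRecurrence n m a b z w x := by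
  obtain ⟨m, rfl⟩ := Nat.exists_eq_add_of_le' hm
  have halg := toda_algebraic n m hsub a b
  rw [TodaRecurrence, Nat.add_sub_cancel, halg]
  rw [← Umom_zero n (m + 1)]
  push_cast
  rcases mul_eq_zero.1 h0 with h | h
  · rw [h] at hsub ⊢
    rw [Umom_of_z_eq_zero n (m + 1) 1, Umom_of_z_eq_zero n (m + 1) 2]
    linear_combination (2 * degU n (m + 1) * Umom n (m + 1) 0 0 (w x) a b ^ 2) * hsub
  · rw [h] at hsub ⊢
    rw [Umom_of_w_eq_zero n (m + 1) 1, Umom_of_w_eq_zero n (m + 1) 2]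
    linear_combination (2 * degU n (m + 1) * Umom n (m + 1) 0 (z x) 0 a b ^ 2) * hsub

theorem hasDerivAt_of_two_mul_sq {f : ℂ → ℂ} {Ω : Set ℂ} (hΩ : IsOpen Ω)
    (hf : DifferentiableOn ℂ f Ω) (c : ℂ)
    (hsq : ∀ t ∈ Ω, (2 * f t) ^ 2 = Complex.exp t + Complex.exp (-t) + c) {t : ℂ} (ht : t ∈ Ω)
    (h0 : f t ≠ 0) : HasDerivAt f ((Complex.exp t - Complex.exp (-t)) / 8 / f t) t := by
  have hd := (hf.differentiableAt (hΩ.mem_nhds ht)).hasDerivAt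
  have h1 := (hd.const_mul 2).fun_pow 2
  have h2 : HasDerivAt (fun t => Complex.exp t + Complex.exp (-t) + c)
      (Complex.exp t - Complex.exp (-t)) t := by
    refine (((Complex.hasDerivAt_exp t).add (hasDerivAt_neg t).cexp).add_const c).congr_deriv ?_
    ring
  have h3 := h1.unique (h2.congr_of_eventuallyEq
    (Filter.eventually_of_mem (hΩ.mem_nhds ht) fun s hs => hsq s hs))
  refine hd.congr_deriv ?_
  rw [← h3]
  field_simp
  push_cast
  ring

theorem todaRecurrence_complex (n : ℕ) {m : ℕ} (hm : 1 ≤ m) (a b : ℂ) {Ω : Set ℂ} {z w : ℂ → ℂ}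
    (hΩ : IsOpen Ω) (hz : DifferentiableOn ℂ z Ω) (hw : DifferentiableOn ℂ w Ω)
    (hzsq : ∀ t ∈ Ω, (2 * z t) ^ 2 = Complex.exp t + Complex.exp (-t) - 2)
    (hwsq : ∀ t ∈ Ω, (2 * w t) ^ 2 = Complex.exp t + Complex.exp (-t) + 2) {x : ℂ} (hx : x ∈ Ω) :
    TodaRecurrence n m a b z w x := by
  have hsub : ∀ t ∈ Ω, w t ^ 2 - z t ^ 2 = 1 := fun t ht => by
    linear_combination (hwsq t ht - hzsq t ht) / 4
  by_cases h0 : z x * w x = 0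
  · exact todaRecurrence_of_mul_eq_zero h0 (hsub x hx) n hm a b
  have hzc := (hz.differentiableAt (hΩ.mem_nhds hx)).continuousAt
  have hwc := (hw.differentiableAt (hΩ.mem_nhds hx)).continuousAt
  refine todaRecurrence_of_hasDerivAt
    (h := fun t => (Complex.exp t - Complex.exp (-t)) / 8) ?_ ?_ n hm a b
  · filter_upwards [hΩ.mem_nhds hx, hzc.eventually_ne (left_ne_zero_of_mul h0),
      hwc.eventually_ne (right_ne_zero_of_mul h0)] with t ht hzt hwt
    refine ⟨hzt, hwt, hasDerivAt_of_two_mul_sq hΩ hz (-2) (fun s hs => by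
      rw [hzsq s hs]; ring) ht hzt, hasDerivAt_of_two_mul_sq hΩ hw 2 hwsq ht hwt, hsub t ht, ?_⟩
    have h5 : Complex.exp t * Complex.exp (-t) = 1 := by rw [← Complex.exp_add]; simp
    linear_combination (-1 / 4) * h5 - w t ^ 2 / 4 * hzsq t ht
      - (Complex.exp t + Complex.exp (-t) - 2) / 16 * hwsq t ht
  · refine (((Complex.hasDerivAt_exp x).sub (hasDerivAt_neg x).cexp).div_const 8).congr_deriv ?_
    linear_combination (-1 / 16) * (hzsq x hx + hwsq x hx)

/-! ### Umemura's recurrence -/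

/-- The product `low` over an arbitrary commutative ring. -/
def lowIn {R : Type*} [CommRing R] (x : R) : ℕ → R
  | 0 => 1
  | 1 => x
  | k + 2 => lowIn x k * (x + ((k : R) + 1) ^ 2)

theorem lowIn_complex (x : ℂ) : ∀ k, lowIn x k = low x k
  | 0 => rfl
  | 1 => by simp [lowIn, low, bar]
  | k + 2 => by
    rw [lowIn, low, lowIn_complex x k, bar]
    push_cast
    ring

theorem map_lowIn {R S : Type*} [CommRing R] [CommRing S] (f : R →+* S) (x : R) :
    ∀ k, f (lowIn x k) = lowIn (f x) k
  | 0 => by simp [lowIn]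
  | 1 => by simp [lowIn]
  | k + 2 => by simp [lowIn, map_lowIn f x k]

/-- `ParamPoly.value` as a ring homomorphism. -/
def valueHom (b₁ b₂ v : ℂ) : ParamPoly →+* ℂ :=
  Polynomial.eval₂RingHom
    (MvPolynomial.aeval ![b₁, b₂] : MvPolynomial (Fin 2) ℚ →ₐ[ℚ] ℂ).toRingHom v

theorem valueHom_apply (b₁ b₂ v : ℂ) (P : ParamPoly) :
    valueHom b₁ b₂ v P = ParamPoly.value P b₁ b₂ v := rfl

theorem valueHom_X (b₁ b₂ v : ℂ) : valueHom b₁ b₂ v Polynomial.X = v := by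
  simp [valueHom]

theorem valueHom_C (b₁ b₂ v : ℂ) (p : MvPolynomial (Fin 2) ℚ) :
    valueHom b₁ b₂ v (Polynomial.C p) = MvPolynomial.aeval ![b₁, b₂] p := by
  simp [valueHom]

theorem valueHom_algebraMap (b₁ b₂ v : ℂ) (q : ℚ) :
    valueHom b₁ b₂ v (algebraMap ℚ ParamPoly q) = q := by
  exact eq_ratCast ((valueHom b₁ b₂ v).comp (algebraMap ℚ ParamPoly)) q

theorem valueHom_smul (b₁ b₂ v : ℂ) (q : ℚ) (P : ParamPoly) :
    valueHom b₁ b₂ v (q • P) = q * valueHom b₁ b₂ v P := by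
  rw [Algebra.smul_def, map_mul, valueHom_algebraMap]

theorem valueHom_param_zero (b₁ b₂ v : ℂ) : valueHom b₁ b₂ v (param 0) = b₁ := by
  simp [param, valueHom_C]

theorem valueHom_param_one (b₁ b₂ v : ℂ) : valueHom b₁ b₂ v (param 1) = b₂ := by
  simp [param, valueHom_C]

/-- A polynomial is determined by its values at complex arguments. -/
theorem eq_of_valueHom_eq {P Q : ParamPoly}
    (h : ∀ b₁ b₂ v, valueHom b₁ b₂ v P = valueHom b₁ b₂ v Q) : P = Q := by
  rw [← sub_eq_zero]
  ext1 k
  rw [Polynomial.coeff_zero]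
  set p := (P - Q).coeff k with hp
  have hval : ∀ b : Fin 2 → ℂ, MvPolynomial.aeval b p = 0 := by
    intro b
    have hb : ![b 0, b 1] = b := by ext i; fin_cases i <;> rfl
    set φ := (MvPolynomial.aeval b : MvPolynomial (Fin 2) ℚ →ₐ[ℚ] ℂ).toRingHom
    have hmap : (P - Q).map φ = 0 := by
      refine Polynomial.funext fun v => ?_
      have h1 := h (b 0) (b 1) v
      rw [← sub_eq_zero, ← map_sub] at h1
      rw [Polynomial.eval_map, Polynomial.eval_zero, ← h1, valueHom, hb]
      rfl
    have := congrArg (fun R => Polynomial.coeff R k) hmap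
    simp only [Polynomial.coeff_map, Polynomial.coeff_zero] at this
    exact this
  have h0 : MvPolynomial.map (algebraMap ℚ ℂ) p = 0 := by
    refine MvPolynomial.funext fun b => ?_
    rw [MvPolynomial.eval_map, ← MvPolynomial.aeval_def, hval, map_zero]
  exact MvPolynomial.map_injective _ (algebraMap ℚ ℂ).injective (by rw [h0, map_zero])

/-- The coefficient of `z^|I| w^|Iᶜ|` in `U 0 m 0` as a polynomial in the parameters. -/
def paramCoeff (m : ℕ) (I : Finset ℕ) : MvPolynomial (Fin 2) ℚ :=
  MvPolynomial.C (dCoeff 0 m I * (-1) ^ cExp 0 I) *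
    ((∏ i ∈ I, lowIn (-4 * MvPolynomial.X 0 ^ 2) i) *
      ∏ i ∈ idx 0 m \ I, lowIn (-4 * MvPolynomial.X 1 ^ 2) i)

/-- `Umom 0 m r` as a polynomial in `v`. -/
def umomPoly (m r : ℕ) : ParamPoly :=
  ∑ I ∈ (idx 0 m).powerset,
    Polynomial.C (paramCoeff m I * ((∑ i ∈ I, (i : MvPolynomial (Fin 2) ℚ)) -
      ∑ i ∈ idx 0 m \ I, (i : MvPolynomial (Fin 2) ℚ)) ^ r) *
      ((1 / 4 : ℚ) • (Polynomial.X - 2)) ^ ((∑ i ∈ I, i) / 2) *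
      ((1 / 4 : ℚ) • (Polynomial.X + 2)) ^ ((∑ i ∈ idx 0 m \ I, i) / 2)

theorem two_dvd_sum_of_subset_idx {m : ℕ} {I : Finset ℕ} (hI : I ⊆ idx 0 m) : 2 ∣ ∑ i ∈ I, i := by
  refine dvd_sum fun i hi => ?_
  have := hI hi
  simp only [idx, mem_union, mem_Icc, mem_image, zero_add] at this
  rcases this with h | ⟨j, _, rfl⟩
  · omega
  · exact dvd_mul_right 2 j

theorem valueHom_umomPoly (m r : ℕ) {b₁ b₂ v z w : ℂ} (hz : -z ^ 2 = (2 - v) / 4)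
    (hw : w ^ 2 = (2 + v) / 4) :
    valueHom b₁ b₂ v (umomPoly m r) = Umom 0 m r z w (-4 * b₁ ^ 2) (-4 * b₂ ^ 2) := by
  rw [umomPoly, Umom, map_sum]
  refine sum_congr rfl fun I hI => ?_
  have hI' := mem_powerset.1 hI
  have e1 : z ^ (∑ i ∈ I, i) = (z ^ 2) ^ ((∑ i ∈ I, i) / 2) := by
    rw [← pow_mul, Nat.mul_div_cancel' (two_dvd_sum_of_subset_idx hI')]
  have e2 : w ^ (∑ i ∈ idx 0 m \ I, i) = (w ^ 2) ^ ((∑ i ∈ idx 0 m \ I, i) / 2) := by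
    rw [← pow_mul, Nat.mul_div_cancel' (two_dvd_sum_of_subset_idx sdiff_subset)]
  have q1 : valueHom b₁ b₂ v ((1 / 4 : ℚ) • (Polynomial.X - 2)) = z ^ 2 := by
    rw [valueHom_smul, map_sub, valueHom_X, map_ofNat]
    push_cast
    linear_combination hz
  have q2 : valueHom b₁ b₂ v ((1 / 4 : ℚ) • (Polynomial.X + 2)) = w ^ 2 := by
    rw [valueHom_smul, map_add, valueHom_X, map_ofNat]
    push_cast
    linear_combination -hw
  have hl : ∀ (j : Fin 2) (i : ℕ), MvPolynomial.aeval ![b₁, b₂]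
      (lowIn (-4 * MvPolynomial.X j ^ 2 : MvPolynomial (Fin 2) ℚ) i) =
      low (-4 * ![b₁, b₂] j ^ 2) i := by
    intro j i
    have := map_lowIn (MvPolynomial.aeval ![b₁, b₂] : MvPolynomial (Fin 2) ℚ →ₐ[ℚ] ℂ).toRingHom
      (-4 * MvPolynomial.X j ^ 2) i
    rw [lowIn_complex] at this
    simpa using this
  rw [map_mul, map_mul, map_pow, map_pow, q1, q2, valueHom_C, paramCoeff, eTerm]
  simp only [map_mul, map_pow, map_sub, map_sum, map_prod, map_natCast, hl, MvPolynomial.aeval_C,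
    Icc_eq_empty_of_lt Nat.zero_lt_one, sdiff_empty, e1, e2]
  simp
  ring

/-- The counterpart of `hasDerivAt_Umom` in `v`: on `(v - 2)^α (v + 2)^β` the operator `(v² - 4)
d/dv` acts as `(α + β) v + 2(α - β)`, where `α + β = e` and `2(α - β)` is the eigenvalue of `D`. -/
theorem umomPoly_derivative {m e : ℕ} (he : degU 0 m = 2 * e) (r : ℕ) :
    (Polynomial.X ^ 2 - 4) * (umomPoly m r).derivative =
      umomPoly m (r + 1) + (e : ParamPoly) * Polynomial.X * umomPoly m r := by
  unfold umomPoly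
  rw [Polynomial.derivative_sum, mul_sum, mul_sum, ← sum_add_distrib]
  refine sum_congr rfl fun I hI => ?_
  have hI' := mem_powerset.1 hI
  obtain ⟨α, hα⟩ := two_dvd_sum_of_subset_idx hI'
  obtain ⟨β, hβ⟩ := two_dvd_sum_of_subset_idx (m := m) (I := idx 0 m \ I) sdiff_subset
  have hαβ : α + β = e := by
    have := sum_add_sum_idx_sdiff hI
    omega
  have h1 : (∑ i ∈ I, (i : MvPolynomial (Fin 2) ℚ)) = 2 * α := by
    rw [← Nat.cast_sum, hα]; push_cast; rfl
  have h2 : (∑ i ∈ idx 0 m \ I, (i : MvPolynomial (Fin 2) ℚ)) = 2 * β := by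
    rw [← Nat.cast_sum, hβ]; push_cast; rfl
  rw [h1, h2, hα, hβ, Nat.mul_div_cancel_left _ two_pos, Nat.mul_div_cancel_left _ two_pos, ← hαβ]
  set q : ParamPoly := algebraMap ℚ ParamPoly (1 / 4) with hq
  have hq4 : 4 * q = 1 := by
    rw [hq, ← map_ofNat (algebraMap ℚ ParamPoly) 4, ← map_mul]
    norm_num
  have hqd : q.derivative = 0 := by
    rw [hq, Polynomial.algebraMap_apply, Polynomial.derivative_C]
  set A : ParamPoly := (1 / 4 : ℚ) • (Polynomial.X - 2) with hA
  set B : ParamPoly := (1 / 4 : ℚ) • (Polynomial.X + 2) with hB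
  have hA' : A = q * (Polynomial.X - 2) := by rw [hA, Algebra.smul_def]
  have hB' : B = q * (Polynomial.X + 2) := by rw [hB, Algebra.smul_def]
  have hdA : A.derivative = q := by
    rw [hA', Polynomial.derivative_mul, hqd]
    simp
  have hdB : B.derivative = q := by
    rw [hB', Polynomial.derivative_mul, hqd]
    simp
  have hpow : ∀ (P : ParamPoly) (k : ℕ),
      P * (P ^ k).derivative = (k : ParamPoly) * P ^ k * P.derivative := by
    intro P k
    obtain _ | k := k
    · simp
    · rw [Polynomial.derivative_pow_succ, pow_succ]
      simp
      ring
  have h3 := hpow A α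
  have h4 := hpow B β
  rw [hdA] at h3
  rw [hdB] at h4
  rw [Polynomial.derivative_mul, Polynomial.derivative_mul, Polynomial.derivative_C,
    show (2 * (α : MvPolynomial (Fin 2) ℚ) - 2 * β) ^ (r + 1) =
      (2 * (α : MvPolynomial (Fin 2) ℚ) - 2 * β) ^ r * (2 * α - 2 * β) from pow_succ _ _,
    ← mul_assoc (paramCoeff m I), Polynomial.C_mul (b := 2 * (α : MvPolynomial (Fin 2) ℚ) - 2 * β)]
  simp only [map_sub, map_mul, map_ofNat, map_natCast]
  push_cast
  have h4A : 4 * A = Polynomial.X - 2 := by linear_combination 4 * hA' + (Polynomial.X - 2) * hq4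
  have h4B : 4 * B = Polynomial.X + 2 := by linear_combination 4 * hB' + (Polynomial.X + 2) * hq4
  have hX : (Polynomial.X ^ 2 - 4 : ParamPoly) = 16 * A * B := by
    linear_combination -(Polynomial.X + 2) * h4A - 4 * A * h4B
  have h16A : 16 * q * A = Polynomial.X - 2 := by linear_combination 4 * A * hq4 + h4A
  have h16B : 16 * q * B = Polynomial.X + 2 := by linear_combination 4 * B * hq4 + h4B
  clear_value A B q
  generalize Polynomial.C (paramCoeff m I) = c
  generalize Polynomial.C ((2 * (α : MvPolynomial (Fin 2) ℚ) - 2 * β) ^ r) = c'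
  generalize (A ^ α).derivative = dA at *
  generalize (B ^ β).derivative = dB at *
  generalize A ^ α = Pa at *
  generalize B ^ β = Pb at *
  linear_combination c * c' * (dA * Pb + Pa * dB) * hX + 16 * c * c' * B * Pb * h3 +
    16 * c * c' * A * Pa * h4 + c * c' * Pa * Pb * α * h16B + c * c' * Pa * Pb * β * h16A

/-- The right-hand side of Umemura's recurrence. -/
def umemuraRhs (n : ℕ) (P : ParamPoly) : ParamPoly :=
  ((1 / 4 : ℚ) • (-2 * param 0 ^ 2 - 2 * param 1 ^ 2
      + (param 0 ^ 2 - param 1 ^ 2) * Polynomial.X)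
    + algebraMap ℚ ParamPoly (((n : ℚ) - 1 / 2) ^ 2)) * P ^ 2
  + (1 / 4 : ℚ) • ((Polynomial.X ^ 2 - 4) ^ 2 *
      (P * P.derivative.derivative - P.derivative ^ 2))
  + (1 / 4 : ℚ) • ((Polynomial.X ^ 2 - 4) * Polynomial.X * P * P.derivative)

/-- The Umemura polynomials. -/
def umemuraT : ℕ → ParamPoly
  | 0 => 1
  | m + 1 => (1 / 2 ^ (m * (m + 1)) : ℚ) • umomPoly m 0

theorem valueHom_umemuraT (m : ℕ) {b₁ b₂ v z w : ℂ} (hz : -z ^ 2 = (2 - v) / 4)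
    (hw : w ^ 2 = (2 + v) / 4) :
    U 0 m 0 z w (-4 * b₁ ^ 2) (-4 * b₂ ^ 2) =
      2 ^ (m * (m + 1)) * valueHom b₁ b₂ v (umemuraT (m + 1)) := by
  rw [umemuraT, valueHom_smul, valueHom_umomPoly m 0 hz hw, Umom_zero]
  push_cast
  rw [← mul_assoc, mul_one_div_cancel (pow_ne_zero _ two_ne_zero), one_mul]

theorem degU_zero (m : ℕ) : ∃ e, degU 0 m = 2 * e :=
  two_dvd_sum_of_subset_idx (subset_refl (idx 0 m))

/-- The right side is the moment expression of `toda_algebraic`, since `v = 2(z² + w²)`; the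
first-derivative term on the left belongs to the change of variable. -/
theorem hirota_umomPoly (m : ℕ) :
    (Polynomial.X ^ 2 - 4) ^ 2 * (umomPoly m 0 * (umomPoly m 0).derivative.derivative -
        (umomPoly m 0).derivative ^ 2) +
      (Polynomial.X ^ 2 - 4) * Polynomial.X * umomPoly m 0 * (umomPoly m 0).derivative =
      umomPoly m 0 * umomPoly m 2 - umomPoly m 1 ^ 2 - Polynomial.X * umomPoly m 0 * umomPoly m 1
        - 2 * (degU 0 m : ParamPoly) * umomPoly m 0 ^ 2 := by
  obtain ⟨e, he⟩ := degU_zero m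
  have h0 := umomPoly_derivative he 0
  have h1 := umomPoly_derivative he 1
  have h2 := congrArg Polynomial.derivative h0
  have h2' : 2 * Polynomial.X * (umomPoly m 0).derivative +
      (Polynomial.X ^ 2 - 4) * (umomPoly m 0).derivative.derivative =
      (umomPoly m 1).derivative + ((e : ParamPoly) * umomPoly m 0 +
        (e : ParamPoly) * Polynomial.X * (umomPoly m 0).derivative) := by
    have hC : (Polynomial.C 2 : ParamPoly) = 2 := rfl
    simpa [Polynomial.derivative_mul, Polynomial.derivative_pow, hC] using h2
  clear h2
  simp only [zero_add, Nat.reduceAdd] at h0 h1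
  rw [he]
  push_cast
  generalize umomPoly m 0 = P₀ at *
  generalize umomPoly m 1 = P₁ at *
  generalize umomPoly m 2 = P₂ at *
  generalize P₀.derivative.derivative = P₀'' at *
  generalize P₀.derivative = P₀' at *
  generalize P₁.derivative = P₁' at *
  linear_combination (Polynomial.X ^ 2 - 4) * P₀ * h2' + P₀ * h1 +
    ((e - 1) * Polynomial.X * P₀ - ((Polynomial.X ^ 2 - 4) * P₀' + P₁ +
      (e : ParamPoly) * Polynomial.X * P₀)) * h0

theorem umemuraRhs_smul (n : ℕ) (c : ℚ) (P : ParamPoly) :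
    umemuraRhs n (c • P) = c ^ 2 • umemuraRhs n P := by
  rw [umemuraRhs, umemuraRhs, Polynomial.derivative_smul, Polynomial.derivative_smul]
  simp only [Algebra.smul_def, map_pow]
  ring

theorem U_zero_zero (z w a b : ℂ) : U 0 0 0 z w a b = 1 := by
  simp [U, idx, dCoeff, cExp, eTerm]

theorem U_zero_one_zero (z w a b : ℂ) :
    U 0 1 0 z w a b = -(a + 1) * z ^ 2 + (b + 1) * w ^ 2 := by
  have hidx : idx 0 1 = {2} := by decide
  have hp : ({2} : Finset ℕ).powerset = {∅, {2}} := by decide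
  simp [U, hidx, hp, dCoeff, cExp, eTerm, low, bar, filter_singleton]
  ring

theorem exists_sq_eq (c : ℂ) : ∃ x : ℂ, x ^ 2 = c :=
  IsAlgClosed.exists_pow_nat_eq c two_pos

theorem isUmemuraSeq_umemuraT : IsUmemuraSeq umemuraT := by
  have hval : ∀ (m : ℕ) (b₁ b₂ v z w : ℂ), -z ^ 2 = (2 - v) / 4 → w ^ 2 = (2 + v) / 4 →
      valueHom b₁ b₂ v (umemuraT (m + 1)) =
        (1 / 2 ^ (m * (m + 1))) * U 0 m 0 z w (-4 * b₁ ^ 2) (-4 * b₂ ^ 2) := by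
    intro m b₁ b₂ v z w hz hw
    rw [valueHom_umemuraT m hz hw, ← mul_assoc, one_div_mul_cancel (pow_ne_zero _ two_ne_zero), one_mul]
  have h1 : umemuraT 1 = 1 := by
    refine eq_of_valueHom_eq fun b₁ b₂ v => ?_
    obtain ⟨z, hz⟩ := exists_sq_eq ((v - 2) / 4)
    obtain ⟨w, hw⟩ := exists_sq_eq ((2 + v) / 4)
    rw [hval 0 b₁ b₂ v z w (by rw [hz]; ring) hw, U_zero_zero]
    simp
  refine ⟨rfl, h1, fun n hn => ?_⟩
  change _ = umemuraRhs n (umemuraT n)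
  refine eq_of_valueHom_eq fun b₁ b₂ v => ?_
  obtain ⟨z, hz⟩ := exists_sq_eq ((v - 2) / 4)
  obtain ⟨w, hw⟩ := exists_sq_eq ((2 + v) / 4)
  have hz' : -z ^ 2 = (2 - v) / 4 := by rw [hz]; ring
  obtain _ | _ | m := n
  · omega
  -- `T_0` is not one of the `U_{0,m}`, so the case `n = 1` is checked directly.
  · rw [map_mul, zero_add, h1, hval 1 b₁ b₂ v z w hz' hw, U_zero_one_zero, umemuraRhs]
    simp only [map_add, map_mul, valueHom_smul, valueHom_algebraMap, map_sub, map_pow, map_neg,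
      map_ofNat, map_one, valueHom_param_zero, valueHom_param_one, valueHom_X, hz, hw, umemuraT,
      Nat.sub_self, Polynomial.derivative_one, map_zero]
    push_cast
    ring
  · have hrhs : umemuraRhs (m + 2) (umomPoly (m + 1) 0) =
        ((1 / 4 : ℚ) • (-2 * param 0 ^ 2 - 2 * param 1 ^ 2
            + (param 0 ^ 2 - param 1 ^ 2) * Polynomial.X)
            + algebraMap ℚ ParamPoly ((((m + 2 : ℕ) : ℚ) - 1 / 2) ^ 2)) * umomPoly (m + 1) 0 ^ 2 +
          (1 / 4 : ℚ) • (umomPoly (m + 1) 0 * umomPoly (m + 1) 2 - umomPoly (m + 1) 1 ^ 2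
            - Polynomial.X * umomPoly (m + 1) 0 * umomPoly (m + 1) 1
            - 2 * (degU 0 (m + 1) : ParamPoly) * umomPoly (m + 1) 0 ^ 2) := by
      rw [← hirota_umomPoly, umemuraRhs, smul_add (_ : ℚ) ((_ : ParamPoly) * (_ - _)), add_assoc]
    have halg := toda_algebraic 0 m (z := z) (w := w) (by rw [hz, hw]; ring)
      (-4 * b₁ ^ 2) (-4 * b₂ ^ 2)
    rw [U_zero_one] at halg
    have hT : umemuraT (m + 1 + 1) = (1 / 2 ^ ((m + 1) * (m + 1 + 1)) : ℚ) • umomPoly (m + 1) 0 :=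
      rfl
    rw [Nat.add_sub_cancel, map_mul, hval m b₁ b₂ v z w hz' hw, hval (m + 2) b₁ b₂ v z w hz' hw, hT,
      umemuraRhs_smul, valueHom_smul, hrhs]
    simp only [map_add, map_mul, valueHom_smul, valueHom_algebraMap, map_sub, map_pow, map_neg,
      map_ofNat, map_natCast, valueHom_param_zero, valueHom_param_one, valueHom_X,
      valueHom_umomPoly _ _ hz' hw]
    -- The exponents satisfy `m(m+1) + (m+2)(m+3) = 2(m+1)(m+2) + 2`; the excess 2 is the factor
    -- `1/4` in Umemura's recurrence.
    have hc : (1 / 2 ^ (m * (m + 1)) : ℂ) * (1 / 2 ^ ((m + 2) * (m + 2 + 1))) =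
        (1 / 2 ^ ((m + 1) * (m + 1 + 1))) ^ 2 * (1 / 4) := by
      rw [one_div_mul_one_div, one_div_pow, one_div_mul_one_div, ← pow_add, ← pow_mul,
        show (4 : ℂ) = 2 ^ 2 by norm_num, ← pow_add]
      congr 2
      ring
    rw [bar, bar, hz, hw] at halg
    rw [Umom_zero]
    push_cast at halg ⊢
    linear_combination U 0 m 0 z w (-4 * b₁ ^ 2) (-4 * b₂ ^ 2) *
      U 0 (m + 2) 0 z w (-4 * b₁ ^ 2) (-4 * b₂ ^ 2) * hc +
      ((1 / 2 ^ ((m + 1) * (m + 1 + 1))) ^ 2 * (1 / 4)) * halg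

/-! ### Nonvanishing and uniqueness of the Umemura polynomials -/

theorem low_zero_ne_zero (k : ℕ) : low 0 (2 * k) ≠ 0 := by
  induction k with
  | zero => simp [low]
  | succ k ih =>
    rw [mul_add, mul_one, low]
    refine mul_ne_zero ih ?_
    rw [bar, zero_add]
    refine pow_ne_zero 2 ?_
    push_cast
    have : (2 * (k : ℂ) + 2 - 1) = ((2 * k + 1 : ℕ) : ℂ) := by push_cast; ring
    rw [this]
    exact Nat.cast_ne_zero.2 (by omega)

/-- At `z = 0`, `w = 1` only `I = ∅` remains; with `b = 0` and even indices it is a product of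
squares of odd numbers. This point corresponds to `v = 2`, `b₁ = b₂ = 0`. -/
theorem U_zero_m_zero_ne_zero (m : ℕ) : U 0 m 0 0 1 0 0 ≠ 0 := by
  have hmem : ∀ i ∈ idx 0 m, ∃ j, 1 ≤ j ∧ i = 2 * j := by
    intro i hi
    simp only [idx, mem_union, mem_Icc, mem_image, zero_add] at hi
    rcases hi with h | ⟨j, hj, rfl⟩
    · omega
    · exact ⟨j, hj.1, rfl⟩
  rw [← Umom_zero, Umom, sum_eq_single ∅]
  · simp only [dCoeff, cExp, eTerm, prod_empty, filter_empty, sum_empty, sdiff_empty, pow_zero,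
      one_pow, mul_one, empty_sdiff, Rat.cast_one, one_mul]
    refine prod_ne_zero_iff.2 fun i hi => ?_
    obtain ⟨j, -, rfl⟩ := hmem i hi
    exact low_zero_ne_zero j
  · intro I hI hne
    obtain ⟨i, hi⟩ := nonempty_iff_ne_empty.2 hne
    obtain ⟨j, hj, rfl⟩ := hmem i (mem_powerset.1 hI hi)
    have : ∑ i ∈ I, i ≠ 0 := by
      have : 2 * j ≤ ∑ i ∈ I, i := single_le_sum (f := fun i => i) (fun _ _ => Nat.zero_le _) hi
      omega
    simp [eTerm, zero_pow this]
  · simp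

theorem umemuraT_ne_zero (n : ℕ) : umemuraT n ≠ 0 := by
  obtain _ | m := n
  · exact one_ne_zero
  · intro h
    have h1 := valueHom_umemuraT m (b₁ := 0) (b₂ := 0) (v := 2) (z := 0) (w := 1)
      (by norm_num) (by norm_num)
    rw [h, map_zero, mul_zero] at h1
    refine U_zero_m_zero_ne_zero m ?_
    simpa using h1

theorem IsUmemuraSeq.eq_umemuraT {T : ℕ → ParamPoly} (hT : IsUmemuraSeq T) : T = umemuraT := by
  have key : ∀ n, T n = umemuraT n ∧ T (n + 1) = umemuraT (n + 1) := by
    intro n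
    induction n with
    | zero =>
      exact ⟨hT.1.trans isUmemuraSeq_umemuraT.1.symm, hT.2.1.trans isUmemuraSeq_umemuraT.2.1.symm⟩
    | succ n ih =>
      refine ⟨ih.2, ?_⟩
      have h1 := hT.2.2 (n + 1) (by omega)
      have h2 := isUmemuraSeq_umemuraT.2.2 (n + 1) (by omega)
      rw [Nat.add_sub_cancel, ih.1, ih.2] at h1
      rw [Nat.add_sub_cancel] at h2
      exact mul_left_cancel₀ (umemuraT_ne_zero n) (h1.trans h2.symm)
  exact funext fun n => (key n).1

end Umemura
end

theorem theorem1 :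
    -- the recurrence for real `x`, with the (nonnegative) square roots
    (∀ (n m : ℕ), 1 ≤ m → ∀ (a b : ℂ) (x : ℝ), x ≠ 0 →
      Umemura.TodaRecurrence n m a b
        (fun t : ℝ => ((1 / 2 * √(Real.exp t + Real.exp (-t) - 2) : ℝ) : ℂ))
        (fun t : ℝ => ((1 / 2 * √(Real.exp t + Real.exp (-t) + 2) : ℝ) : ℂ)) x) ∧
    -- the recurrence for complex `x`, with any holomorphic branches of the square roots
    (∀ (n m : ℕ), 1 ≤ m → ∀ (a b : ℂ) (Ω : Set ℂ) (z w : ℂ → ℂ), IsOpen Ω →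
      DifferentiableOn ℂ z Ω → DifferentiableOn ℂ w Ω →
      (∀ t ∈ Ω, (2 * z t) ^ 2 = Complex.exp t + Complex.exp (-t) - 2) →
      (∀ t ∈ Ω, (2 * w t) ^ 2 = Complex.exp t + Complex.exp (-t) + 2) →
      ∀ x ∈ Ω, Umemura.TodaRecurrence n m a b z w x) ∧
    -- for `n = 0` the last term of the recurrence vanishes
    (∀ (m : ℕ) (z w a b : ℂ), Umemura.U 0 m 1 z w a b = 0) ∧
    -- Umemura's recurrence determines the polynomials `T_n`, and `U_{0,m}` is an Umemura polynomial
    (∃! T : ℕ → Umemura.ParamPoly, Umemura.IsUmemuraSeq T) ∧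
    (∀ T : ℕ → Umemura.ParamPoly, Umemura.IsUmemuraSeq T →
      ∀ (m : ℕ) (b₁ b₂ v z w : ℂ), -z ^ 2 = (2 - v) / 4 → w ^ 2 = (2 + v) / 4 →
        Umemura.U 0 m 0 z w (-4 * b₁ ^ 2) (-4 * b₂ ^ 2) =
          2 ^ (m * (m + 1)) * Umemura.ParamPoly.value (T (m + 1)) b₁ b₂ v) := by
  refine ⟨fun n m hm a b x hx => Umemura.todaRecurrence_real n hm a b hx,
    fun n m hm a b Ω z w hΩ hz hw hzsq hwsq x hx =>
      Umemura.todaRecurrence_complex n hm a b hΩ hz hw hzsq hwsq hx,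
    Umemura.U_zero_one,
    ⟨Umemura.umemuraT, Umemura.isUmemuraSeq_umemuraT, fun T hT => hT.eq_umemuraT⟩,
    fun T hT m b₁ b₂ v z w hz hw => ?_⟩
  rw [hT.eq_umemuraT, ← Umemura.valueHom_apply]
  exact Umemura.valueHom_umemuraT m hz hw
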